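/- Let $d\in\{2,3\}$, let $\Omega\subset\mathbb R^d$ be a bounded convex polytope (the nonempty interior of the convex hull of finitely many points), and let $\boldsymbol A\in L^\infty(\Omega;\mathbb R^d)$ satisfy $\operatorname{div}\boldsymbol A=0$ in $\Omega$ and $\boldsymbol A\cdot\mathbf n=0$ on $\partial\Omega$ in the weak sense. Regard $L^2(\Omega)=L^2(\Omega;\mathbb C)$ and $H^1(\Omega)=H^1(\Omega;\mathbb C)$ as real Hilbert spaces, with $(v,w)_{L^2(\Omega)}=\operatorname{Re}\int_\Omega v\,w^*\,dx$, where $w^*$ is the complex conjugate (for vector fields $v\,w^*$ is replaced by $v\cdot w^*$). For $\kappa>0$ and $\beta\ge 0$ put $$\|v\|_{H^1_\kappa(\Omega)}^2=\|v\|_{L^2(\Omega)}^2+\kappa^{-2}\|\nabla v\|_{L^2(\Omega)}^2,$$ $$a_\beta(v,w)=\big(\tfrac{\mathrm i}{\kappa}\nabla v+\boldsymbol A v,\ \tfrac{\mathrm i}{\kappa}\nabla w+\boldsymbol A w\big)_{L^2(\Omega)}+\beta\,(v,w)_{L^2(\Omega)}.$$ Let $\mathcal T_h$ be a conforming partition of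 $\Omega$ into closed triangles ($d=2$) or tetrahedra ($d=3$), with mesh size $h=\max_{T\in\mathcal T_h}\operatorname{diam}T$. It is shape-regular with constant $\sigma$ if every $T\in\mathcal T_h$ contains a ball of some diameter $\rho>0$ with $\operatorname{diam}T\le\sigma\rho$, and quasi-uniform with constant $\tau$ if $h\le\tau\operatorname{diam}T$ for every $T\in\mathcal T_h$. Let $V_h=\{v\in H^1(\Omega): v|_T \text{ is affine for all } T\in\mathcal T_h\}$ be the space of complex-valued $\mathbb P^1$ finite elements, let $\pi_h:H^1(\Omega)\to V_h$ be the $L^2$-projection, given by $(\pi_hv,v_h)_{L^2(\Omega)}=(v,v_h)_{L^2(\Omega)}$ for all $v_h\in V_h$, and let $W=\{v\in H^1(\Omega):\pi_hv=0\}$. Then there is a constant $C_{\mathrm{res}}>0$, depending only on $\boldsymbol A$, $\Omega$ and the mesh regularity constants $\sigma,\tau$, such that for every mesh $\mathcal T_h$ with these constants, every $\kappa>0$ with $h\le C_{\mathrm{res}}\kappa^{-1}$ and every $\beta\ge0$: 1. $a_\beta(w,w)\ \ge\ \tfrac14\|w\|_{H^1_\kappa(\Omega)}^2+\beta\,\|w\|_{L^2(\Omega)}^2$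 for all $w\in W$. 2. Consequently the corrector and the LOD space are well-defined: for every $v\in H^1(\Omega)$ there is exactly one $\mathcal Cv\in W$ with $a_\beta(\mathcal Cv,w)=a_\beta(v,w)$ for all $w\in W$; the map $\mathcal C:H^1(\Omega)\to W$ is linear and continuous, and the LOD space $\{v_h-\mathcal Cv_h: v_h\in V_h\}$ is the linear subspace $(I-\mathcal C)V_h$ of $H^1(\Omega)$. -/

import Mathlib

open MeasureTheory

noncomputable section

namespace GinzburgLandau

/-- Euclidean space `ℝᵈ`. -/
abbrev Space (d : ℕ) := EuclideanSpace ℝ (Fin d)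

/-- A bounded convex polytope domain: the nonempty interior of the convex hull of finitely many
points. -/
def IsConvexPolytope {d : ℕ} (Ω : TopologicalSpace.Opens (Space d)) : Prop :=
  (Ω : Set (Space d)).Nonempty ∧
    ∃ S : Finset (Space d), (Ω : Set (Space d)) = interior (convexHull ℝ (S : Set (Space d)))

/-! ### Function spaces -/

/-- `L²(Ω; ℂ)`, used as a real Hilbert space. -/
abbrev L2 {d : ℕ} (Ω : TopologicalSpace.Opens (Space d)) :=
  Lp ℂ 2 (volume.restrict (Ω : Set (Space d)))

/-- `L²(Ω; ℂ) × L²(Ω; ℂ)ᵈ` with its Hilbert norm. -/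
abbrev L2Jet {d : ℕ} (Ω : TopologicalSpace.Opens (Space d)) :=
  WithLp 2 (L2 Ω × PiLp 2 (fun _ : Fin d => L2 Ω))

/-- Smooth compactly supported real test functions on `Ω`. -/
structure IsTestFunction {d : ℕ} (Ω : TopologicalSpace.Opens (Space d))
    (φ : Space d → ℝ) : Prop where
  smooth : ContDiff ℝ (⊤ : ℕ∞) φ
  compact : HasCompactSupport φ
  support_subset : tsupport φ ⊆ (Ω : Set (Space d))

/-- The classical partial derivative `∂ᵢ φ`. -/
def partialDeriv {d : ℕ} (i : Fin d) (φ : Space d → ℝ) (x : Space d) : ℝ :=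
  fderiv ℝ φ x (EuclideanSpace.single i 1)

/-- `g` is the weak partial derivative `∂ᵢ u` in `Ω`. -/
def HasWeakPartial {d : ℕ} (Ω : TopologicalSpace.Opens (Space d)) (i : Fin d)
    (u g : Space d → ℂ) : Prop :=
  ∀ φ : Space d → ℝ, IsTestFunction Ω φ →
    ∫ x in Ω, u x * (partialDeriv i φ x : ℂ) = - ∫ x in Ω, g x * (φ x : ℂ)

theorem IsTestFunction.memLp {d : ℕ} {Ω : TopologicalSpace.Opens (Space d)} {φ : Space d → ℝ}
    (hφ : IsTestFunction Ω φ) :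
    MemLp (fun x => (φ x : ℂ)) 2 (volume.restrict (Ω : Set (Space d))) :=
  Continuous.memLp_of_hasCompactSupport (Complex.continuous_ofReal.comp hφ.smooth.continuous)
    (hφ.compact.comp_left Complex.ofReal_zero)

theorem IsTestFunction.memLp_partialDeriv {d : ℕ} {Ω : TopologicalSpace.Opens (Space d)}
    {φ : Space d → ℝ} (hφ : IsTestFunction Ω φ) (i : Fin d) :
    MemLp (fun x => (partialDeriv i φ x : ℂ)) 2 (volume.restrict (Ω : Set (Space d))) :=
  Continuous.memLp_of_hasCompactSupport
    (Complex.continuous_ofReal.comp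
      ((hφ.smooth.continuous_fderiv (by simp)).clm_apply continuous_const))
    (HasCompactSupport.comp_left (g := ((↑) : ℝ → ℂ))
      (hφ.compact.fderiv_apply ℝ (EuclideanSpace.single i 1)) Complex.ofReal_zero)

/-- The Sobolev space `H¹(Ω; ℂ)` as a real Hilbert space. Its elements are the functions
`v ∈ L²(Ω; ℂ)` with weak gradient in `L²(Ω; ℂ)ᵈ`; each is stored together with that gradient,
which it determines (see `toL2_injective`). -/
def H1 {d : ℕ} (Ω : TopologicalSpace.Opens (Space d)) : Submodule ℝ (L2Jet Ω) where
  carrier := {v | ∀ i, HasWeakPartial Ω i (v.fst : L2 Ω) (v.snd i : L2 Ω)}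
  zero_mem' := by
    intro i φ hφ
    have h0 := Lp.coeFn_zero ℂ 2 (volume.restrict (Ω : Set (Space d)))
    have h : ∀ ψ : Space d → ℝ, ∫ x in Ω, (0 : L2 Ω) x * (ψ x : ℂ) = 0 := by
      intro ψ
      rw [integral_congr_ae (g := fun _ => (0 : ℂ)), integral_zero]
      filter_upwards [h0] with x hx
      rw [hx, Pi.zero_apply, zero_mul]
    change ∫ x in Ω, (0 : L2 Ω) x * _ = - ∫ x in Ω, (0 : L2 Ω) x * _
    rw [h, h, neg_zero]
  add_mem' := by
    intro u v hu hv i φ hφ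
    have h : ∀ (f g : L2 Ω) (ψ : Space d → ℝ),
        MemLp (fun x => (ψ x : ℂ)) 2 (volume.restrict (Ω : Set (Space d))) →
        ∫ x in Ω, (f + g : L2 Ω) x * (ψ x : ℂ) =
          (∫ x in Ω, f x * (ψ x : ℂ)) + ∫ x in Ω, g x * (ψ x : ℂ) := by
      intro f g ψ hψ
      refine Eq.trans (integral_congr_ae ?_)
        (integral_add ((Lp.memLp f).integrable_mul hψ) ((Lp.memLp g).integrable_mul hψ))
      filter_upwards [Lp.coeFn_add f g] with x hx
      rw [hx, Pi.add_apply, add_mul]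
    change ∫ x in Ω, (u.fst + v.fst : L2 Ω) x * _ = - ∫ x in Ω, (u.snd i + v.snd i : L2 Ω) x * _
    rw [h _ _ _ (hφ.memLp_partialDeriv i), h _ _ _ hφ.memLp, hu i φ hφ, hv i φ hφ, neg_add]
  smul_mem' := by
    intro c u hu i φ hφ
    have h : ∀ (f : L2 Ω) (ψ : Space d → ℝ),
        ∫ x in Ω, (c • f : L2 Ω) x * (ψ x : ℂ) = (c : ℂ) * ∫ x in Ω, f x * (ψ x : ℂ) := by
      intro f ψ
      rw [← integral_const_mul]
      refine integral_congr_ae ?_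
      filter_upwards [Lp.coeFn_smul c f] with x hx
      simp [hx, mul_assoc]
    change ∫ x in Ω, (c • u.fst : L2 Ω) x * _ = - ∫ x in Ω, (c • u.snd i : L2 Ω) x * _
    rw [h, h, hu i φ hφ, mul_neg]

/-- The embedding `H¹(Ω) → L²(Ω)`. -/
def toL2 {d : ℕ} (Ω : TopologicalSpace.Opens (Space d)) : H1 Ω →ₗ[ℝ] L2 Ω :=
  (WithLp.fstₗ 2 ℝ (L2 Ω) (PiLp 2 (fun _ : Fin d => L2 Ω))).comp (H1 Ω).subtype

/-- The weak partial derivative `∂ᵢ v` of `v ∈ H¹(Ω)`. -/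
def grad {d : ℕ} {Ω : TopologicalSpace.Opens (Space d)} (v : H1 Ω) (i : Fin d) : L2 Ω :=
  (v : L2Jet Ω).snd i

theorem toL2_injective {d : ℕ} (Ω : TopologicalSpace.Opens (Space d)) :
    Function.Injective (toL2 Ω) := by
  rw [injective_iff_map_eq_zero]
  intro v hv
  have hv1 : (v : L2Jet Ω).fst = 0 := hv
  have hg : ∀ i, (v : L2Jet Ω).snd i = 0 := by
    intro i
    rw [Lp.eq_zero_iff_ae_eq_zero]
    have hloc : LocallyIntegrableOn ((v : L2Jet Ω).snd i : Space d → ℂ)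
        (Ω : Set (Space d)) volume := by
      have h1 : LocallyIntegrable ((v : L2Jet Ω).snd i : Space d → ℂ)
          (volume.restrict (Ω : Set (Space d))) :=
        (Lp.memLp ((v : L2Jet Ω).snd i)).locallyIntegrable (by norm_num)
      exact locallyIntegrableOn_of_locallyIntegrable_restrict h1
    have key := Ω.isOpen.ae_eq_zero_of_integral_contDiff_smul_eq_zero hloc (by
      intro φ h1 h2 h3
      have hφ : IsTestFunction Ω φ := ⟨h1, h2, h3⟩
      have h4 := v.2 i φ hφ
      have h5 : ∫ x in Ω, ((v : L2Jet Ω).fst : L2 Ω) x * (partialDeriv i φ x : ℂ) = 0 := by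
        rw [hv1, integral_congr_ae (g := fun _ => (0 : ℂ)), integral_zero]
        filter_upwards [Lp.coeFn_zero ℂ 2 (volume.restrict (Ω : Set (Space d)))] with x hx
        rw [hx, Pi.zero_apply, zero_mul]
      rw [h5] at h4
      rw [← setIntegral_eq_integral_of_forall_compl_eq_zero (s := (Ω : Set (Space d)))]
      · have h6 := neg_eq_zero.mp h4.symm
        rw [← h6]
        refine integral_congr_ae (Filter.Eventually.of_forall fun x => ?_)
        simp [mul_comm]
      · intro x hx
        rw [image_eq_zero_of_notMem_tsupport (fun h => hx (h3 h)), zero_smul])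
    exact (ae_restrict_iff' Ω.isOpen.measurableSet).mpr key
  apply Subtype.ext
  apply WithLp.ofLp_injective
  refine Prod.ext hv1 ?_
  exact PiLp.ext hg

/-! ### Norms and the magnetic form -/

/-- The real inner product `(v, w) = Re ∫_Ω v w*` on `L²(Ω; ℂ)`. -/
def l2Inner {d : ℕ} {Ω : TopologicalSpace.Opens (Space d)} (v w : L2 Ω) : ℝ :=
  (∫ x in Ω, v x * (starRingEnd ℂ) (w x)).re

/-- `‖v‖²_{H¹_κ} = ‖v‖²_{L²} + κ⁻² ‖∇v‖²_{L²}`. -/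
def normH1κSq {d : ℕ} {Ω : TopologicalSpace.Opens (Space d)} (κ : ℝ) (v : H1 Ω) : ℝ :=
  ‖toL2 Ω v‖ ^ 2 + 1 / κ ^ 2 * ∑ i, ‖grad v i‖ ^ 2

/-- The `i`-th component of `(i/κ) ∇v + A v`. -/
def magGrad {d : ℕ} {Ω : TopologicalSpace.Opens (Space d)} (A : Space d → Space d) (κ : ℝ)
    (v : H1 Ω) (i : Fin d) (x : Space d) : ℂ :=
  Complex.I / (κ : ℂ) * grad v i x + (A x i : ℂ) * toL2 Ω v x

/-- The magnetic form
`a_β(v, w) = Re ∫_Ω ((i/κ) ∇v + A v) · ((i/κ) ∇w + A w)* + β Re ∫_Ω v w*`. -/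
def aForm {d : ℕ} {Ω : TopologicalSpace.Opens (Space d)} (A : Space d → Space d) (κ β : ℝ)
    (v w : H1 Ω) : ℝ :=
  (∫ x in Ω, ∑ i, magGrad A κ v i x * (starRingEnd ℂ) (magGrad A κ w i x)).re +
    β * l2Inner (toL2 Ω v) (toL2 Ω w)

/-- `div A = 0` in `Ω`, in the sense of distributions. -/
def IsDivFree {d : ℕ} (Ω : TopologicalSpace.Opens (Space d)) (A : Space d → Space d) : Prop :=
  ∀ φ : Space d → ℝ, IsTestFunction Ω φ → ∫ x in Ω, fderiv ℝ φ x (A x) = 0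

/-- `A · n = 0` on `∂Ω` for a divergence-free field `A`, in the weak sense given by Green's
formula: `∫_Ω A · ∇φ = 0` for all test functions that need not vanish on `∂Ω`. -/
def HasZeroNormalTrace {d : ℕ} (Ω : TopologicalSpace.Opens (Space d))
    (A : Space d → Space d) : Prop :=
  ∀ φ : Space d → ℝ, ContDiff ℝ (⊤ : ℕ∞) φ → HasCompactSupport φ →
    ∫ x in Ω, fderiv ℝ φ x (A x) = 0

/-! ### Triangulations and finite elements -/

/-- A conforming partition of `Ω` into simplices (triangles for `d = 2`, tetrahedra for `d = 3`).
A simplex is given by its `d + 1` affinely independent vertices; two simplices intersect exactly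
in the (possibly empty) face spanned by their common vertices. -/
structure Triangulation {d : ℕ} (Ω : TopologicalSpace.Opens (Space d)) where
  cells : Finset (Finset (Space d))
  card_eq : ∀ T ∈ cells, T.card = d + 1
  affineIndependent : ∀ T ∈ cells, AffineIndependent ℝ ((↑) : T → Space d)
  cover : ⋃ T ∈ cells, convexHull ℝ (T : Set (Space d)) = closure (Ω : Set (Space d))
  conforming : ∀ T ∈ cells, ∀ T' ∈ cells,
    convexHull ℝ (T : Set (Space d)) ∩ convexHull ℝ (T' : Set (Space d)) =
      convexHull ℝ ((T : Set (Space d)) ∩ (T' : Set (Space d)))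

namespace Triangulation

variable {d : ℕ} {Ω : TopologicalSpace.Opens (Space d)}

/-- The maximum mesh size `h = max {diam T | T ∈ 𝒯}`. -/
def meshSize (𝒯 : Triangulation Ω) : ℝ :=
  ⨆ T : 𝒯.cells, Metric.diam (convexHull ℝ ((T : Finset (Space d)) : Set (Space d)))

/-- Shape regularity with constant `σ`: each simplex `T` contains a ball of diameter `ρ > 0` with
`diam T ≤ σ ρ`. -/
def IsShapeRegular (𝒯 : Triangulation Ω) (σ : ℝ) : Prop :=
  ∀ T ∈ 𝒯.cells, ∃ (x : Space d) (ρ : ℝ), 0 < ρ ∧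
    Metric.closedBall x (ρ / 2) ⊆ convexHull ℝ (T : Set (Space d)) ∧
    Metric.diam (convexHull ℝ (T : Set (Space d))) ≤ σ * ρ

/-- Quasi-uniformity with constant `τ`: `h ≤ τ diam T` for each simplex `T`. -/
def IsQuasiUniform (𝒯 : Triangulation Ω) (τ : ℝ) : Prop :=
  ∀ T ∈ 𝒯.cells, 𝒯.meshSize ≤ τ * Metric.diam (convexHull ℝ (T : Set (Space d)))

/-- `u` coincides on each simplex `T` almost everywhere with the affine function `p T`. -/
def IsPiecewise (𝒯 : Triangulation Ω) (u : Space d → ℂ) (p : 𝒯.cells → (Space d →ᵃ[ℝ] ℂ)) :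
    Prop :=
  ∀ T : 𝒯.cells, ∀ᵐ x ∂(volume.restrict (Ω : Set (Space d))),
    x ∈ convexHull ℝ ((T : Finset (Space d)) : Set (Space d)) → u x = p T x

theorem isPiecewise_zero (𝒯 : Triangulation Ω) : 𝒯.IsPiecewise (0 : L2 Ω) 0 := by
  intro T
  filter_upwards [Lp.coeFn_zero ℂ 2 (volume.restrict (Ω : Set (Space d)))] with x hx _
  rw [hx]
  simp

theorem isPiecewise_add (𝒯 : Triangulation Ω) {u v : L2 Ω} {p q : 𝒯.cells → (Space d →ᵃ[ℝ] ℂ)}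
    (hu : 𝒯.IsPiecewise u p) (hv : 𝒯.IsPiecewise v q) :
    𝒯.IsPiecewise (u + v : L2 Ω) (p + q) := by
  intro T
  filter_upwards [hu T, hv T, Lp.coeFn_add u v] with x h1 h2 h3 hx
  rw [h3, Pi.add_apply, h1 hx, h2 hx]
  simp

theorem isPiecewise_smul (𝒯 : Triangulation Ω) (c : ℝ) {u : L2 Ω}
    {p : 𝒯.cells → (Space d →ᵃ[ℝ] ℂ)} (hu : 𝒯.IsPiecewise u p) :
    𝒯.IsPiecewise (c • u : L2 Ω) (c • p) := by
  intro T
  filter_upwards [hu T, Lp.coeFn_smul c u] with x h1 h2 hx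
  rw [h2, Pi.smul_apply, h1 hx]
  simp

/-- The conforming `P1` Lagrange space `V_h = {v ∈ H¹(Ω) | v|_T ∈ P1(T) for all T}`. -/
def Vh (𝒯 : Triangulation Ω) : Submodule ℝ (H1 Ω) where
  carrier := {v | ∃ p : 𝒯.cells → (Space d →ᵃ[ℝ] ℂ), 𝒯.IsPiecewise (toL2 Ω v) p}
  zero_mem' := ⟨0, by simpa using 𝒯.isPiecewise_zero⟩
  add_mem' := by
    rintro u v ⟨p, hp⟩ ⟨q, hq⟩
    exact ⟨p + q, by rw [map_add]; exact 𝒯.isPiecewise_add hp hq⟩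
  smul_mem' := by
    rintro c u ⟨p, hp⟩
    exact ⟨c • p, by rw [map_smul]; exact 𝒯.isPiecewise_smul c hp⟩

instance finiteDimensional_Vh (𝒯 : Triangulation Ω) : FiniteDimensional ℝ 𝒯.Vh := by
  classical
  have : FiniteDimensional ℝ (Space d →ᵃ[ℝ] ℂ) :=
    Module.Finite.equiv (AffineMap.toConstProdLinearMap ℝ (k := ℝ)
      (V1 := Space d) (V2 := ℂ)).symm
  let G : Submodule ℝ (H1 Ω × (𝒯.cells → (Space d →ᵃ[ℝ] ℂ))) :=
    { carrier := {z | 𝒯.IsPiecewise (toL2 Ω z.1) z.2}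
      zero_mem' := by simpa using 𝒯.isPiecewise_zero
      add_mem' := by
        intro a b ha hb
        change 𝒯.IsPiecewise (toL2 Ω (a.1 + b.1)) (a.2 + b.2)
        rw [map_add]
        exact 𝒯.isPiecewise_add ha hb
      smul_mem' := by
        intro c a ha
        change 𝒯.IsPiecewise (toL2 Ω (c • a.1)) (c • a.2)
        rw [map_smul]
        exact 𝒯.isPiecewise_smul c ha }
  have hinj : Function.Injective
      ((LinearMap.snd ℝ (H1 Ω) (𝒯.cells → (Space d →ᵃ[ℝ] ℂ))).comp G.subtype) := by
    rw [injective_iff_map_eq_zero]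
    rintro ⟨⟨v, p⟩, hz⟩ hp
    have hp' : p = 0 := hp
    have hz' : 𝒯.IsPiecewise (toL2 Ω v) p := hz
    subst hp'
    have hv : v = 0 := by
      apply toL2_injective Ω
      rw [map_zero, Lp.eq_zero_iff_ae_eq_zero]
      have hall : ∀ᵐ x ∂(volume.restrict (Ω : Set (Space d))), ∀ T : 𝒯.cells,
          x ∈ convexHull ℝ ((T : Finset (Space d)) : Set (Space d)) → toL2 Ω v x = 0 := by
        rw [ae_all_iff]
        intro T
        filter_upwards [hz' T] with x hx hxT
        simpa using hx hxT
      filter_upwards [hall, ae_restrict_mem Ω.isOpen.measurableSet] with x hx hxΩ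
      have hc : x ∈ ⋃ T ∈ 𝒯.cells, convexHull ℝ (T : Set (Space d)) := by
        rw [𝒯.cover]
        exact subset_closure hxΩ
      simp only [Set.mem_iUnion] at hc
      obtain ⟨T, hT, hxT⟩ := hc
      exact hx ⟨T, hT⟩ hxT
    subst hv
    rfl
  have : FiniteDimensional ℝ G := Module.Finite.of_injective _ hinj
  have hmap : 𝒯.Vh = G.map (LinearMap.fst ℝ (H1 Ω) (𝒯.cells → (Space d →ᵃ[ℝ] ℂ))) := by
    ext v
    constructor
    · rintro ⟨p, hp⟩
      exact ⟨(v, p), hp, rfl⟩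
    · rintro ⟨⟨u, p⟩, hz, rfl⟩
      exact ⟨p, hz⟩
  rw [hmap]
  infer_instance

/-- `V_h` as a subspace of `L²(Ω)`. -/
def VhL2 (𝒯 : Triangulation Ω) : Submodule ℝ (L2 Ω) := 𝒯.Vh.map (toL2 Ω)

instance finiteDimensional_VhL2 (𝒯 : Triangulation Ω) : FiniteDimensional ℝ 𝒯.VhL2 := by
  unfold VhL2
  infer_instance

/-- The `L²`-projection `π_h : H¹(Ω) → V_h`. -/
def l2Proj (𝒯 : Triangulation Ω) : H1 Ω →ₗ[ℝ] 𝒯.Vh :=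
  ((𝒯.Vh.equivMapOfInjective (toL2 Ω) (toL2_injective Ω)).symm.toLinearMap.comp
    (𝒯.VhL2.orthogonalProjectionOnto : L2 Ω →ₗ[ℝ] 𝒯.VhL2)).comp (toL2 Ω)

/-- The defining property `(π_h v, v_h) = (v, v_h)` for all `v_h ∈ V_h`. -/
theorem l2Inner_l2Proj (𝒯 : Triangulation Ω) (v : H1 Ω) (vh : 𝒯.Vh) :
    l2Inner (toL2 Ω (𝒯.l2Proj v)) (toL2 Ω vh) = l2Inner (toL2 Ω v) (toL2 Ω vh) := by
  have hin : ∀ f g : L2 Ω, l2Inner f g = inner ℝ f g := by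
    intro f g
    have hint : Integrable (fun x => f x * (starRingEnd ℂ) (g x))
        (volume.restrict (Ω : Set (Space d))) :=
      (Lp.memLp f).integrable_mul (Lp.memLp g).star
    rw [L2.inner_def, l2Inner]
    refine (integral_re hint).symm.trans (integral_congr_ae ?_)
    refine Filter.Eventually.of_forall fun x => ?_
    simp [Complex.inner]
    ring
  have hp : toL2 Ω (𝒯.l2Proj v) = 𝒯.VhL2.orthogonalProjectionOnto (toL2 Ω v) := by
    have := Submodule.coe_equivMapOfInjective_apply (toL2 Ω) (toL2_injective Ω) 𝒯.Vh (𝒯.l2Proj v)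
    rw [← this]
    congr 1
    exact LinearEquiv.apply_symm_apply _ _
  rw [hin, hin, hp]
  exact Submodule.inner_orthogonalProjectionOnto_eq_of_mem_right
    (⟨toL2 Ω vh, vh, vh.2, rfl⟩ : 𝒯.VhL2) (toL2 Ω v)

/-- The detail space `W = ker π_h ⊆ H¹(Ω)`. -/
def W (𝒯 : Triangulation Ω) : Submodule ℝ (H1 Ω) := LinearMap.ker 𝒯.l2Proj

/-- `c = 𝒞 v` for the ideal corrector `𝒞`: `c ∈ W` and `a_β(c, w) = a_β(v, w)` for all
`w ∈ W`. -/
def IsCorrector (𝒯 : Triangulation Ω) (A : Space d → Space d) (κ β : ℝ) (v c : H1 Ω) : Prop :=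
  c ∈ 𝒯.W ∧ ∀ w ∈ 𝒯.W, aForm A κ β c w = aForm A κ β v w

/-- The LOD space `(I - 𝒞) V_h`, for the relation `c = 𝒞 v` above. -/
def lodSpace (𝒯 : Triangulation Ω) (A : Space d → Space d) (κ β : ℝ) : Set (H1 Ω) :=
  {u | ∃ vh ∈ 𝒯.Vh, ∃ c, 𝒯.IsCorrector A κ β vh c ∧ u = vh - c}

end Triangulation

end GinzburgLandau

end

open GinzburgLandau

/-!
The magnetic form is coercive on `W = ker π_h` because `W` satisfies a Poincaré inequality at the
scale of the mesh, `‖w‖ ≤ C h ‖∇w‖` (`Triangulation.norm_toL2_sq_le_meshSize_sq`). Gårding's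
inequality `le_aForm_self` leaves a zeroth-order defect proportional to `‖w‖²`, and the resolution
condition `h ≤ C_res κ⁻¹` makes it small compared with `κ⁻² ‖∇w‖²`. Existence, uniqueness, linearity
and continuity of the corrector then follow from Lax–Milgram on the closed subspace `W` of the
complete space `H¹(Ω)`.

Since `w ∈ W` is `L²`-orthogonal to `V_h`, the Poincaré inequality follows from an approximation
`v ∈ V_h` of `w` with `‖w - v‖ ≤ C h ‖∇w‖` (`Triangulation.exists_mem_Vh_norm_sub_sq_le`). The nodal
value of `v` at a vertex is the mean of `w` over the inscribed ball of one cell at that vertex. At a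
point `x` the value of `v` is a convex combination of nodal values, so the error is controlled by
the mean of `|w(x) - w(y)|²` over points `y` at distance at most `2 h`. Integrated over `x`, this mean oscillation is bounded by the gradient
(`lintegral_lintegral_enorm_sq_sub_le`): on a convex domain, a difference `w(x + ξ) - w(x)` is the
integral of the weak derivative along the segment (`zeroExt_add_sub_eq_integral`).

That the interpolant lies in `H¹(Ω)` holds because a continuous piecewise affine function on a
convex domain is Lipschitz (`lipschitzOnWith_of_finite_closed_cover`), and Lipschitz functions have
bounded weak derivatives (`exists_H1_of_lipschitzOnWith`).
-/

open Set Filter Topology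
open scoped NNReal ENNReal

/-! ### Lipschitz and piecewise affine functions in `H¹` -/

namespace GinzburgLandau

/-- Lipschitz bounds on finitely many closed pieces add up to a Lipschitz bound on a convex set
covered by the pieces: a segment is followed by continuous induction, and at every parameter one
of the pieces contains parameters arbitrarily close on the right. -/
theorem lipschitzOnWith_of_finite_closed_cover {E F ι : Type*} [NormedAddCommGroup E]
    [NormedSpace ℝ E] [PseudoMetricSpace F] [Finite ι] {s : Set E} (hs : Convex ℝ s)
    {t : ι → Set E} (ht : ∀ i, IsClosed (t i)) (hst : s ⊆ ⋃ i, t i) {f : E → F} {K : ℝ≥0}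
    (hf : ∀ i, LipschitzOnWith K f (t i)) : LipschitzOnWith K f s := by
  have hcont : ContinuousOn f (⋃ i, t i) :=
    (locallyFinite_of_finite t).continuousOn_iUnion ht fun i => (hf i).continuousOn
  refine LipschitzOnWith.of_dist_le_mul fun x hx y hy => ?_
  set γ : ℝ → E := fun r => AffineMap.lineMap x y r with hγ
  have hγc : Continuous γ := AffineMap.lineMap_continuous
  have hγs : ∀ r ∈ Icc (0 : ℝ) 1, γ r ∈ ⋃ i, t i := fun r hr =>
    hst (hs.lineMap_mem hx hy hr)
  have hfγ : ContinuousOn (fun r => f (γ r)) (Icc 0 1) := hcont.comp hγc.continuousOn hγs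
  have key : Icc (0 : ℝ) 1 ⊆ {r | dist (f x) (f (γ r)) ≤ K * (r * dist x y)} := by
    apply IsClosed.Icc_subset_of_forall_exists_gt
    · have := isClosed_Icc.isClosed_le (s := Icc (0 : ℝ) 1)
        (f := fun r => dist (f x) (f (γ r))) (g := fun r => K * (r * dist x y))
        ((LipschitzWith.dist_right (f x)).continuous.comp_continuousOn hfγ) (by fun_prop)
      convert! this using 1
      ext r
      simp [and_comm]
    · simp [hγ]
    · rintro a ⟨ha, ha01⟩ b hb
      obtain ⟨i, hi⟩ : ∃ i, ∃ᶠ r in 𝓝[>] a, γ r ∈ t i := by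
        by_contra! hcon
        have h1 : ∀ᶠ r in 𝓝[>] a, ∀ i, γ r ∉ t i :=
          eventually_all.2 fun i => hcon i
        have h2 : ∀ᶠ r in 𝓝[>] a, r ∈ Ioo a 1 := Ioo_mem_nhdsGT ha01.2
        obtain ⟨r, h3, h4⟩ := (h1.and h2).exists
        obtain ⟨i, hi⟩ := mem_iUnion.1 (hγs r ⟨ha01.1.trans h4.1.le, h4.2.le⟩)
        exact h3 i hi
      have hai : γ a ∈ t i :=
        (ht i).mem_of_frequently_of_tendsto hi
          ((hγc.tendsto a).mono_left nhdsWithin_le_nhds)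
      have h2 : ∀ᶠ r in 𝓝[>] a, r ∈ Ioo a b := Ioo_mem_nhdsGT hb
      obtain ⟨r, hr, hrab⟩ := (hi.and_eventually h2).exists
      refine ⟨r, ?_, hrab.1, hrab.2.le⟩
      have h3 := (hf i).dist_le_mul _ hai _ hr
      rw [dist_lineMap_lineMap, Real.dist_eq, abs_sub_comm, abs_of_pos (sub_pos.2 hrab.1)] at h3
      have h4 : dist (f x) (f (γ a)) ≤ K * (a * dist x y) := ha
      change dist (f x) (f (γ r)) ≤ K * (r * dist x y)
      linarith [dist_triangle (f x) (f (γ a)) (f (γ r))]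
  have := key (right_mem_Icc.2 zero_le_one)
  simpa [hγ] using this

variable {d : ℕ} {Ω : TopologicalSpace.Opens (Space d)}

theorem HasWeakPartial.congr_ae {i : Fin d} {u u' g g' : Space d → ℂ}
    (h : HasWeakPartial Ω i u g) (hu : u' =ᵐ[volume.restrict (Ω : Set (Space d))] u)
    (hg : g' =ᵐ[volume.restrict (Ω : Set (Space d))] g) : HasWeakPartial Ω i u' g' := by
  intro φ hφ
  have h1 := h φ hφ
  rw [integral_congr_ae (g := fun x => u x * (partialDeriv i φ x : ℂ)),
    integral_congr_ae (f := fun x => g' x * (φ x : ℂ)) (g := fun x => g x * (φ x : ℂ)), h1]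
  · filter_upwards [hg] with x hx
    rw [hx]
  · filter_upwards [hu] with x hx
    rw [hx]

theorem exists_H1_of_hasWeakPartial {u : Space d → ℂ} {g : Fin d → Space d → ℂ}
    (hu : MemLp u 2 (volume.restrict (Ω : Set (Space d))))
    (hg : ∀ i, MemLp (g i) 2 (volume.restrict (Ω : Set (Space d))))
    (h : ∀ i, HasWeakPartial Ω i u (g i)) :
    ∃ v : H1 Ω, toL2 Ω v =ᵐ[volume.restrict (Ω : Set (Space d))] u :=
  ⟨⟨WithLp.toLp 2 (hu.toLp u, WithLp.toLp 2 fun i => (hg i).toLp (g i)), fun i =>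
    (h i).congr_ae hu.coeFn_toLp (hg i).coeFn_toLp⟩, hu.coeFn_toLp⟩

theorem IsTestFunction.lineDeriv_eq {φ : Space d → ℝ} (hφ : IsTestFunction Ω φ) (i : Fin d)
    (x : Space d) : lineDeriv ℝ φ x (EuclideanSpace.single i 1) = partialDeriv i φ x :=
  (hφ.smooth.differentiable (by simp) x).lineDeriv_eq_fderiv

theorem IsTestFunction.eq_zero {φ : Space d → ℝ} (hφ : IsTestFunction Ω φ) {x : Space d}
    (hx : x ∉ (Ω : Set (Space d))) : φ x = 0 :=
  image_eq_zero_of_notMem_tsupport fun h => hx (hφ.support_subset h)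

theorem IsTestFunction.fderiv_eq_zero {φ : Space d → ℝ} (hφ : IsTestFunction Ω φ) {x : Space d}
    (hx : x ∉ (Ω : Set (Space d))) : fderiv ℝ φ x = 0 :=
  image_eq_zero_of_notMem_tsupport fun h =>
    hx (hφ.support_subset (tsupport_fderiv_subset ℝ h))

/-- Integration by parts for a Lipschitz function against a test function on `Ω`. -/
theorem integral_mul_partialDeriv_of_lipschitzWith {K : ℝ≥0} {f : Space d → ℝ}
    (hf : LipschitzWith K f) {φ : Space d → ℝ} (hφ : IsTestFunction Ω φ) (i : Fin d) :
    ∫ x in Ω, f x * partialDeriv i φ x =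
      -∫ x in Ω, lineDeriv ℝ f x (EuclideanSpace.single i 1) * φ x := by
  obtain ⟨D, hD⟩ := ContDiff.lipschitzWith_of_hasCompactSupport hφ.compact hφ.smooth (by simp)
  have h := hf.integral_lineDeriv_mul_eq (μ := volume) hD hφ.compact (EuclideanSpace.single i 1)
  rw [setIntegral_eq_integral_of_forall_compl_eq_zero,
    setIntegral_eq_integral_of_forall_compl_eq_zero, h, ← integral_neg]
  · refine integral_congr_ae (Eventually.of_forall fun x => ?_)
    simp only [lineDeriv_neg, hφ.lineDeriv_eq]
    ring
  · intro x hx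
    rw [hφ.eq_zero hx, mul_zero]
  · intro x hx
    rw [partialDeriv, hφ.fderiv_eq_zero hx, _root_.zero_apply, mul_zero]

theorem memLp_ofReal_add_I_mul {μ : Measure (Space d)} {a b : Space d → ℝ}
    (ha : MemLp a 2 μ) (hb : MemLp b 2 μ) :
    MemLp (fun x => (a x : ℂ) + Complex.I * b x) 2 μ := by
  have h1 : MemLp (fun x => (a x : ℂ)) 2 μ := ha.ofReal
  have h2 : MemLp (fun x => (b x : ℂ)) 2 μ := hb.ofReal
  exact h1.add (h2.const_mul Complex.I)

theorem integral_complex_mul_ofReal {μ : Measure (Space d)} {a b : Space d → ℝ}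
    (ha : MemLp a 2 μ) (hb : MemLp b 2 μ) {ψ : Space d → ℝ}
    (hψ : MemLp (fun x => (ψ x : ℂ)) 2 μ) :
    ∫ x, ((a x : ℂ) + Complex.I * b x) * (ψ x : ℂ) ∂μ =
      ((∫ x, a x * ψ x ∂μ : ℝ) : ℂ) + Complex.I * ((∫ x, b x * ψ x ∂μ : ℝ) : ℂ) := by
  have hψ' : MemLp ψ 2 μ := hψ.re
  have h1 : Integrable (fun x => ((a x * ψ x : ℝ) : ℂ)) μ := (ha.integrable_mul hψ').ofReal
  have h2 : Integrable (fun x => Complex.I * ((b x * ψ x : ℝ) : ℂ)) μ :=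
    (hb.integrable_mul hψ').ofReal.const_mul _
  rw [← integral_complex_ofReal, ← integral_complex_ofReal, ← integral_const_mul,
    ← integral_add h1 h2]
  congr 1 with x
  push_cast
  ring

theorem memLp_of_lipschitzWith (hΩ : Bornology.IsBounded (Ω : Set (Space d)))
    {K : ℝ≥0} {f : Space d → ℝ} (hf : LipschitzWith K f) :
    MemLp f 2 (volume.restrict (Ω : Set (Space d))) := by
  have hfin : IsFiniteMeasure (volume.restrict (Ω : Set (Space d))) :=
    isFiniteMeasure_restrict.2 hΩ.measure_lt_top.ne
  obtain ⟨B, hB⟩ := (hΩ.isCompact_closure.image hf.continuous).isBounded.exists_norm_le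
  refine MemLp.of_bound hf.continuous.aestronglyMeasurable B ?_
  filter_upwards [ae_restrict_mem Ω.isOpen.measurableSet] with x hx
  exact hB _ (mem_image_of_mem f (subset_closure hx))

theorem memLp_lineDeriv_of_lipschitzWith (hΩ : Bornology.IsBounded (Ω : Set (Space d)))
    {K : ℝ≥0} {f : Space d → ℝ} (hf : LipschitzWith K f) (v : Space d) :
    MemLp (fun x => lineDeriv ℝ f x v) 2 (volume.restrict (Ω : Set (Space d))) := by
  have hfin : IsFiniteMeasure (volume.restrict (Ω : Set (Space d))) :=
    isFiniteMeasure_restrict.2 hΩ.measure_lt_top.ne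
  exact (hf.memLp_lineDeriv v).mono_exponent le_top

/-- Lipschitz functions on a bounded domain belong to `H¹(Ω)`. -/
theorem exists_H1_of_lipschitzOnWith (hΩ : Bornology.IsBounded (Ω : Set (Space d)))
    {K : ℝ≥0} {u : Space d → ℂ} (hu : LipschitzOnWith K u (Ω : Set (Space d))) :
    ∃ v : H1 Ω, toL2 Ω v =ᵐ[volume.restrict (Ω : Set (Space d))] u := by
  have hre : LipschitzOnWith K (fun x => (u x).re) (Ω : Set (Space d)) :=
    LipschitzOnWith.of_dist_le_mul fun x hx y hy =>
      ((Complex.abs_re_le_norm (u x - u y)).trans_eq (dist_eq_norm _ _).symm).trans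
        (hu.dist_le_mul x hx y hy)
  have him : LipschitzOnWith K (fun x => (u x).im) (Ω : Set (Space d)) :=
    LipschitzOnWith.of_dist_le_mul fun x hx y hy =>
      ((Complex.abs_im_le_norm (u x - u y)).trans_eq (dist_eq_norm _ _).symm).trans
        (hu.dist_le_mul x hx y hy)
  obtain ⟨f, hf, hfu⟩ := hre.extend_real
  obtain ⟨g, hg, hgu⟩ := him.extend_real
  have hweak : ∀ i, HasWeakPartial Ω i (fun x => (f x : ℂ) + Complex.I * g x)
      (fun x => ((lineDeriv ℝ f x (EuclideanSpace.single i 1) : ℝ) : ℂ) +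
        Complex.I * ((lineDeriv ℝ g x (EuclideanSpace.single i 1) : ℝ) : ℂ)) := by
    intro i φ hφ
    rw [integral_complex_mul_ofReal (memLp_of_lipschitzWith hΩ hf)
        (memLp_of_lipschitzWith hΩ hg) (hφ.memLp_partialDeriv i),
      integral_complex_mul_ofReal (memLp_lineDeriv_of_lipschitzWith hΩ hf _)
        (memLp_lineDeriv_of_lipschitzWith hΩ hg _) hφ.memLp,
      integral_mul_partialDeriv_of_lipschitzWith hf hφ,
      integral_mul_partialDeriv_of_lipschitzWith hg hφ]
    push_cast
    ring
  have hfg : MemLp (fun x => (f x : ℂ) + Complex.I * g x) 2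
      (volume.restrict (Ω : Set (Space d))) :=
    memLp_ofReal_add_I_mul (memLp_of_lipschitzWith hΩ hf) (memLp_of_lipschitzWith hΩ hg)
  obtain ⟨v, hv⟩ := exists_H1_of_hasWeakPartial hfg
    (fun i => memLp_ofReal_add_I_mul (memLp_lineDeriv_of_lipschitzWith hΩ hf _)
      (memLp_lineDeriv_of_lipschitzWith hΩ hg _)) hweak
  refine ⟨v, ?_⟩
  filter_upwards [hv, ae_restrict_mem Ω.isOpen.measurableSet] with x hx hxΩ
  rw [hx, ← hfu hxΩ, ← hgu hxΩ, mul_comm]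
  exact Complex.re_add_im (u x)

namespace IsConvexPolytope

theorem convex (hΩ : IsConvexPolytope Ω) : Convex ℝ (Ω : Set (Space d)) := by
  obtain ⟨S, hS⟩ := hΩ.2
  rw [hS]
  exact (convex_convexHull ℝ _).interior

theorem isBounded (hΩ : IsConvexPolytope Ω) : Bornology.IsBounded (Ω : Set (Space d)) := by
  obtain ⟨S, hS⟩ := hΩ.2
  rw [hS]
  exact ((isBounded_convexHull).2 S.finite_toSet.isBounded).subset interior_subset

theorem interior_closure (hΩ : IsConvexPolytope Ω) :
    interior (closure (Ω : Set (Space d))) = Ω := by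
  rw [hΩ.convex.interior_closure_eq_interior_of_nonempty_interior, Ω.isOpen.interior_eq]
  rw [Ω.isOpen.interior_eq]
  exact hΩ.1

end IsConvexPolytope

namespace Triangulation

theorem isClosed_cell (T : Finset (Space d)) :
    IsClosed (convexHull ℝ (T : Set (Space d))) :=
  T.finite_toSet.isClosed_convexHull ℝ

theorem isBounded_cell (T : Finset (Space d)) :
    Bornology.IsBounded (convexHull ℝ (T : Set (Space d))) :=
  isBounded_convexHull.2 T.finite_toSet.isBounded

/-- On a simplex, the affine function with prescribed vertex values. -/
theorem exists_affineMap_eq_on_vertices (𝒯 : Triangulation Ω) (c : Space d → ℂ)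
    {T : Finset (Space d)} (hT : T ∈ 𝒯.cells) :
    ∃ p : Space d →ᵃ[ℝ] ℂ, ∀ z ∈ T, p z = c z := by
  have hspan : affineSpan ℝ (range ((↑) : T → Space d)) = ⊤ := by
    rw [(𝒯.affineIndependent T hT).affineSpan_eq_top_iff_card_eq_finrank_add_one]
    simp [𝒯.card_eq T hT]
  let b : AffineBasis T ℝ (Space d) := ⟨(↑), 𝒯.affineIndependent T hT, hspan⟩
  refine ⟨∑ z : T, (LinearMap.toSpanSingleton ℝ ℂ (c z)).toAffineMap.comp (b.coord z), ?_⟩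
  intro z hz
  have hsum : ∀ (s : Finset T) (q : T → (Space d →ᵃ[ℝ] ℂ)), (∑ y ∈ s, q y) z = ∑ y ∈ s, q y z := by
    intro s q
    induction s using Finset.cons_induction with
    | empty => simp
    | cons a s ha ih => rw [Finset.sum_cons, Finset.sum_cons, ← ih, AffineMap.coe_add, Pi.add_apply]
  have h1 : ∀ y : T, b.coord y z = if y = ⟨z, hz⟩ then 1 else 0 := by
    intro y
    exact b.coord_apply y ⟨z, hz⟩
  rw [hsum]
  simp [h1, ite_smul]

/-- For every choice of nodal values there is a function of `V_h` that takes these values at the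
vertices, so that its values on a simplex are convex combinations of the nodal values there. -/
theorem exists_mem_Vh_forall_mem_convexHull (𝒯 : Triangulation Ω) (hΩ : IsConvexPolytope Ω)
    (c : Space d → ℂ) :
    ∃ v ∈ 𝒯.Vh, ∀ᵐ x ∂(volume.restrict (Ω : Set (Space d))), ∃ T ∈ 𝒯.cells,
      x ∈ convexHull ℝ (T : Set (Space d)) ∧ toL2 Ω v x ∈ convexHull ℝ (c '' T) := by
  classical
  choose! p hp using fun T hT => 𝒯.exists_affineMap_eq_on_vertices c (T := T) hT
  -- Conformity makes the affine pieces agree on intersections of cells.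
  have hagree : ∀ T ∈ 𝒯.cells, ∀ T' ∈ 𝒯.cells, ∀ x ∈ convexHull ℝ (T : Set (Space d)),
      x ∈ convexHull ℝ (T' : Set (Space d)) → p T x = p T' x := by
    intro T hT T' hT' x hx hx'
    have h1 : x ∈ convexHull ℝ ((T : Set (Space d)) ∩ (T' : Set (Space d))) := by
      rw [← 𝒯.conforming T hT T' hT']
      exact ⟨hx, hx'⟩
    have h2 : Convex ℝ {y | p T y = p T' y} := by
      have : {y | p T y = p T' y} = (p T - p T') ⁻¹' {0} := by
        ext y
        simp [sub_eq_zero]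
      rw [this]
      exact (convex_singleton 0).affine_preimage _
    exact convexHull_min (fun z hz => (hp T hT z hz.1).trans (hp T' hT' z hz.2).symm) h2 h1
  let u : Space d → ℂ := fun x =>
    if h : ∃ T ∈ 𝒯.cells, x ∈ convexHull ℝ (T : Set (Space d)) then p h.choose x else 0
  have hu : ∀ T ∈ 𝒯.cells, ∀ x ∈ convexHull ℝ (T : Set (Space d)), u x = p T x := by
    intro T hT x hx
    have h : ∃ T ∈ 𝒯.cells, x ∈ convexHull ℝ (T : Set (Space d)) := ⟨T, hT, hx⟩
    simp only [u, dif_pos h]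
    exact hagree _ h.choose_spec.1 _ hT _ h.choose_spec.2 hx
  have hcover : closure (Ω : Set (Space d)) ⊆
      ⋃ T : 𝒯.cells, convexHull ℝ ((T : Finset (Space d)) : Set (Space d)) := by
    rw [← 𝒯.cover, iUnion_subtype]
  have hLip : ∀ T : Finset (Space d), ∃ K : ℝ≥0, LipschitzWith K (p T) := by
    intro T
    let q : Space d →L[ℝ] ℂ := LinearMap.toContinuousLinearMap (p T).linear
    refine ⟨‖q‖₊, LipschitzWith.of_dist_le_mul fun x y => ?_⟩
    have := q.le_opNorm (x - y)
    rw [dist_eq_norm, dist_eq_norm, ← vsub_eq_sub (p T x), ← (p T).linearMap_vsub]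
    exact this
  choose K hK using hLip
  have hLipu : LipschitzOnWith (𝒯.cells.sup K) u (closure (Ω : Set (Space d))) := by
    refine lipschitzOnWith_of_finite_closed_cover (hΩ.convex.closure)
      (fun T : 𝒯.cells => isClosed_cell (T : Finset (Space d))) hcover fun T => ?_
    intro x hx y hy
    rw [hu T T.2 x hx, hu T T.2 y hy]
    exact (hK T).weaken (Finset.le_sup T.2) x y
  obtain ⟨v, hv⟩ := exists_H1_of_lipschitzOnWith hΩ.isBounded (hLipu.mono subset_closure)
  refine ⟨v, ⟨fun T => p T, fun T => ?_⟩, ?_⟩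
  · filter_upwards [hv] with x hx hxT
    rw [hx, hu T T.2 x hxT]
  · filter_upwards [hv, ae_restrict_mem Ω.isOpen.measurableSet] with x hx hxΩ
    obtain ⟨T, hxT⟩ := mem_iUnion.1 (hcover (subset_closure hxΩ))
    refine ⟨T, T.2, hxT, ?_⟩
    have h1 : p T '' (T : Set (Space d)) = c '' ((T : Finset (Space d)) : Set (Space d)) :=
      image_congr fun z hz => hp T T.2 z hz
    rw [hx, hu T T.2 x hxT, ← h1, ← AffineMap.image_convexHull]
    exact mem_image_of_mem _ hxT

end Triangulation

end GinzburgLandau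

/-! ### Translation estimates for `H¹` functions on convex domains -/

namespace GinzburgLandau

theorem sq_lintegral_le {α : Type*} [MeasurableSpace α] (μ : Measure α) {f : α → ℝ≥0∞}
    (hf : AEMeasurable f μ) : (∫⁻ x, f x ∂μ) ^ 2 ≤ μ univ * ∫⁻ x, f x ^ 2 ∂μ := by
  have h := ENNReal.lintegral_mul_le_Lp_mul_Lq μ Real.HolderConjugate.two_two
    (aemeasurable_const (b := (1 : ℝ≥0∞))) hf
  have hsq : ∀ a : ℝ≥0∞, (a ^ (1 / 2 : ℝ)) ^ 2 = a := fun a => by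
    rw [← ENNReal.rpow_natCast, ← ENNReal.rpow_mul]
    norm_num
  simp only [Pi.mul_apply, one_mul, ENNReal.rpow_two, one_pow, lintegral_one] at h
  calc (∫⁻ x, f x ∂μ) ^ 2 ≤ _ := pow_le_pow_left' h 2
    _ = _ := by rw [mul_pow, hsq, hsq]

variable {d : ℕ} {Ω : TopologicalSpace.Opens (Space d)}

/-- The extension by zero to `ℝᵈ` of a function on `Ω`. -/
noncomputable def zeroExt (u : L2 Ω) : Space d → ℂ := (Ω : Set (Space d)).indicator u

/-- The extension by zero to `ℝᵈ` of the weak directional derivative `∇v · ξ`. -/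
noncomputable def dirDeriv (v : H1 Ω) (ξ : Space d) : Space d → ℂ :=
  fun x => ∑ i, (ξ i : ℂ) * zeroExt (grad v i) x

theorem stronglyMeasurable_zeroExt (u : L2 Ω) : StronglyMeasurable (zeroExt u) :=
  (Lp.stronglyMeasurable u).indicator Ω.isOpen.measurableSet

theorem integrable_zeroExt (hΩ : Bornology.IsBounded (Ω : Set (Space d))) (u : L2 Ω) :
    Integrable (zeroExt u) := by
  have hfin : IsFiniteMeasure (volume.restrict (Ω : Set (Space d))) :=
    isFiniteMeasure_restrict.2 hΩ.measure_lt_top.ne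
  exact (integrable_indicator_iff Ω.isOpen.measurableSet).2 ((Lp.memLp u).integrable one_le_two)

theorem setLIntegral_enorm_sq (u : L2 Ω) :
    ∫⁻ x in Ω, ‖u x‖ₑ ^ 2 = ENNReal.ofReal (‖u‖ ^ 2) := by
  have h := eLpNorm_nnreal_pow_eq_lintegral (μ := volume.restrict (Ω : Set (Space d)))
    (f := u) (p := 2) two_ne_zero
  rw [ENNReal.ofReal_pow (norm_nonneg _), Lp.norm_def, ENNReal.ofReal_toReal (Lp.eLpNorm_ne_top u)]
  simpa using h.symm

theorem lintegral_enorm_sq_zeroExt (u : L2 Ω) :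
    ∫⁻ x, ‖zeroExt u x‖ₑ ^ 2 = ENNReal.ofReal (‖u‖ ^ 2) := by
  have h : (fun x => ‖zeroExt u x‖ₑ ^ 2) =
      (Ω : Set (Space d)).indicator fun x => ‖u x‖ₑ ^ 2 := by
    ext x
    by_cases hx : x ∈ (Ω : Set (Space d)) <;> simp [zeroExt, hx]
  rw [h, lintegral_indicator Ω.isOpen.measurableSet, setLIntegral_enorm_sq]

theorem stronglyMeasurable_dirDeriv (v : H1 Ω) (ξ : Space d) :
    StronglyMeasurable (dirDeriv v ξ) :=
  Finset.stronglyMeasurable_fun_sum _ fun _ _ =>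
    (stronglyMeasurable_zeroExt _).const_mul _

theorem integrable_dirDeriv (hΩ : Bornology.IsBounded (Ω : Set (Space d))) (v : H1 Ω)
    (ξ : Space d) : Integrable (dirDeriv v ξ) :=
  integrable_finsetSum _ fun _ _ => (integrable_zeroExt hΩ _).const_mul _

theorem lintegral_enorm_sq_dirDeriv_le (v : H1 Ω) (ξ : Space d) :
    ∫⁻ x, ‖dirDeriv v ξ x‖ₑ ^ 2 ≤ ‖ξ‖ₑ ^ 2 * ENNReal.ofReal (∑ i, ‖grad v i‖ ^ 2) := by
  have hpt : ∀ x, ‖dirDeriv v ξ x‖ₑ ^ 2 ≤ ‖ξ‖ₑ ^ 2 * ∑ i, ‖zeroExt (grad v i) x‖ₑ ^ 2 := by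
    intro x
    have h1 : ‖dirDeriv v ξ x‖ ^ 2 ≤ ‖ξ‖ ^ 2 * ∑ i, ‖zeroExt (grad v i) x‖ ^ 2 := by
      rw [EuclideanSpace.norm_sq_eq]
      refine le_trans (pow_le_pow_left₀ (norm_nonneg _) (norm_sum_le _ _) 2) ?_
      simp only [norm_mul, Complex.norm_real]
      exact Finset.sum_mul_sq_le_sq_mul_sq _ _ _
    have h2 := ENNReal.ofReal_le_ofReal h1
    rw [ENNReal.ofReal_mul (by positivity), ENNReal.ofReal_pow (norm_nonneg _),
      ENNReal.ofReal_pow (norm_nonneg _), ENNReal.ofReal_sum_of_nonneg (by intros; positivity)]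
      at h2
    simpa only [ENNReal.ofReal_pow (norm_nonneg _), ofReal_norm] using h2
  calc _ ≤ ∫⁻ x, ‖ξ‖ₑ ^ 2 * ∑ i, ‖zeroExt (grad v i) x‖ₑ ^ 2 := lintegral_mono hpt
    _ = _ := by
      have hm : ∀ i, Measurable fun x => ‖zeroExt (grad v i) x‖ₑ ^ 2 := fun i =>
        (stronglyMeasurable_zeroExt _).measurable.enorm.pow_const 2
      rw [lintegral_const_mul _ (Finset.measurable_fun_sum _ fun i _ => hm i),
        lintegral_finsetSum _ fun i _ => hm i,
        ENNReal.ofReal_sum_of_nonneg (by intros; positivity)]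
      simp only [lintegral_enorm_sq_zeroExt]

theorem integral_zeroExt_mul_fderiv (hΩ : Bornology.IsBounded (Ω : Set (Space d))) (v : H1 Ω)
    (ξ : Space d) {φ : Space d → ℝ} (hφ : IsTestFunction Ω φ) :
    ∫ x, zeroExt (toL2 Ω v) x * ((fderiv ℝ φ x ξ : ℝ) : ℂ) =
      -∫ x, dirDeriv v ξ x * (φ x : ℂ) := by
  have hind : ∀ (u : L2 Ω) (ψ : Space d → ℂ), ∫ x, zeroExt u x * ψ x = ∫ x in Ω, u x * ψ x := by
    intro u ψ
    rw [← integral_indicator Ω.isOpen.measurableSet]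
    congr 1 with x
    by_cases hx : x ∈ (Ω : Set (Space d)) <;> simp [zeroExt, hx]
  have hbdd : ∀ (u : L2 Ω) {ψ : Space d → ℝ}, Continuous ψ → HasCompactSupport ψ →
      Integrable fun x => zeroExt u x * (ψ x : ℂ) := by
    intro u ψ hψ hc
    obtain ⟨B, hB⟩ := hψ.bounded_above_of_compact_support hc
    refine (integrable_zeroExt hΩ u).mul_bdd (c := B)
      (Complex.continuous_ofReal.comp hψ).aestronglyMeasurable (Eventually.of_forall fun x => ?_)
    simpa using hB x
  have hsum : ∀ x, fderiv ℝ φ x ξ = ∑ i, ξ i * partialDeriv i φ x := by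
    intro x
    have h1 : ξ = ∑ i, ξ i • EuclideanSpace.single i (1 : ℝ) := by
      ext j
      simp [Pi.single_apply]
    conv_lhs => rw [h1]
    simp [partialDeriv]
  have hpc : ∀ i, Continuous (partialDeriv i φ) := fun i =>
    (hφ.smooth.continuous_fderiv (by simp)).clm_apply continuous_const
  have hps : ∀ i, HasCompactSupport (partialDeriv i φ) := fun i => hφ.compact.fderiv_apply ℝ _
  calc ∫ x, zeroExt (toL2 Ω v) x * ((fderiv ℝ φ x ξ : ℝ) : ℂ)
      = ∫ x, ∑ i, (ξ i : ℂ) * (zeroExt (toL2 Ω v) x * (partialDeriv i φ x : ℂ)) := by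
        congr 1 with x
        rw [hsum]
        push_cast
        rw [Finset.mul_sum]
        exact Finset.sum_congr rfl fun i _ => by ring
    _ = ∑ i, (ξ i : ℂ) * ∫ x, zeroExt (toL2 Ω v) x * (partialDeriv i φ x : ℂ) := by
        rw [integral_finsetSum _ fun i _ => (hbdd _ (hpc i) (hps i)).const_mul _]
        simp only [integral_const_mul]
    _ = -∑ i, (ξ i : ℂ) * ∫ x, zeroExt (grad v i) x * (φ x : ℂ) := by
        rw [← Finset.sum_neg_distrib]
        refine Finset.sum_congr rfl fun i _ => ?_
        rw [hind, hind]
        have := v.2 i φ hφ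
        rw [← mul_neg]
        exact congrArg _ this
    _ = -∫ x, dirDeriv v ξ x * (φ x : ℂ) := by
        simp only [dirDeriv, Finset.sum_mul, mul_assoc]
        rw [integral_finsetSum _ fun i _ =>
          (hbdd _ hφ.smooth.continuous hφ.compact).const_mul _]
        simp only [integral_const_mul]

/-- On a convex domain the difference `v(x + ξ) - v(x)` is the integral of the weak derivative
along the segment. Tested against `φ`, this is the fundamental theorem of calculus for `φ`;
convexity ensures that the translates `φ(· - tξ)` are test functions on `Ω`. -/
theorem zeroExt_add_sub_eq_integral (hΩ : Bornology.IsBounded (Ω : Set (Space d)))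
    (hconv : Convex ℝ (Ω : Set (Space d))) (v : H1 Ω) (ξ : Space d) :
    ∀ᵐ x, x ∈ (Ω : Set (Space d)) → x + ξ ∈ (Ω : Set (Space d)) →
      zeroExt (toL2 Ω v) (x + ξ) - zeroExt (toL2 Ω v) x =
        ∫ t in Icc (0 : ℝ) 1, dirDeriv v ξ (x + t • ξ) := by
  set f := zeroExt (toL2 Ω v)
  have hfi : Integrable f := integrable_zeroExt hΩ _
  have hHi : Integrable (dirDeriv v ξ) := integrable_dirDeriv hΩ v ξ
  have hprod : Integrable (fun z : Space d × ℝ => dirDeriv v ξ (z.1 + z.2 • ξ))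
      (volume.prod (volume.restrict (Icc (0 : ℝ) 1))) := by
    have hm : AEStronglyMeasurable (fun z : Space d × ℝ => dirDeriv v ξ (z.1 + z.2 • ξ))
        (volume.prod (volume.restrict (Icc (0 : ℝ) 1))) :=
      ((stronglyMeasurable_dirDeriv v ξ).comp_measurable (by fun_prop)).aestronglyMeasurable
    rw [integrable_prod_iff' hm]
    refine ⟨Eventually.of_forall fun t => hHi.comp_add_right (t • ξ), ?_⟩
    have h1 : ∀ t : ℝ, ∫ x, ‖dirDeriv v ξ (x + t • ξ)‖ = ∫ x, ‖dirDeriv v ξ x‖ := fun t =>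
      integral_add_right_eq_self (fun x => ‖dirDeriv v ξ x‖) (t • ξ)
    simp only [h1]
    exact integrable_const _
  set U : Set (Space d) := (Ω : Set (Space d)) ∩ (fun x => x + ξ) ⁻¹' (Ω : Set (Space d))
  have hUo : IsOpen U := Ω.isOpen.inter (Ω.isOpen.preimage (by fun_prop))
  have hDi : Integrable fun x => f (x + ξ) - f x -
      ∫ t in Icc (0 : ℝ) 1, dirDeriv v ξ (x + t • ξ) :=
    ((hfi.comp_add_right ξ).sub hfi).sub hprod.integral_prod_left
  have key := hUo.ae_eq_zero_of_integral_contDiff_smul_eq_zero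
    (hDi.locallyIntegrable.locallyIntegrableOn U) (by
    intro φ h1 h2 h3
    -- The translates of `φ` along the segment are test functions on `Ω`.
    have htest : ∀ t ∈ Icc (0 : ℝ) 1, IsTestFunction Ω fun y => φ (y - t • ξ) := by
      intro t ht
      refine ⟨h1.comp (by fun_prop), h2.comp_homeomorph (Homeomorph.subRight (t • ξ)), ?_⟩
      intro y hy
      have hy1 : y - t • ξ ∈ tsupport φ :=
        tsupport_comp_subset_preimage φ (f := fun y => y - t • ξ) (by fun_prop) hy
      have hy2 := h3 hy1
      have := hconv.lineMap_mem hy2.1 hy2.2 ht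
      simpa [AffineMap.lineMap_apply] using this
    obtain ⟨B, hB⟩ := h1.continuous.bounded_above_of_compact_support h2
    have hψc : Continuous fun x => fderiv ℝ φ x ξ :=
      (h1.continuous_fderiv (by simp)).clm_apply continuous_const
    obtain ⟨B', hB'⟩ := hψc.bounded_above_of_compact_support (h2.fderiv_apply ℝ ξ)
    have hmulφ : ∀ (a : Space d), ∀ {g : Space d → ℂ}, Integrable g →
        Integrable fun x => g x * (φ (x - a) : ℂ) := by
      intro a g hg
      refine hg.mul_bdd (c := B) (Complex.continuous_ofReal.comp
        (h1.continuous.comp (by fun_prop))).aestronglyMeasurable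
        (Eventually.of_forall fun x => ?_)
      simpa using hB (x - a)
    have hderiv : ∀ t ∈ Icc (0 : ℝ) 1, ∫ x, dirDeriv v ξ (x + t • ξ) * (φ x : ℂ) =
        -∫ y, f y * ((fderiv ℝ φ (y - t • ξ) ξ : ℝ) : ℂ) := by
      intro t ht
      have h4 := integral_zeroExt_mul_fderiv hΩ v ξ (htest t ht)
      simp only [fderiv_comp_sub] at h4
      rw [h4, neg_neg,
        ← integral_add_right_eq_self (fun y => dirDeriv v ξ y * (φ (y - t • ξ) : ℂ)) (t • ξ)]
      simp
    have hFTC : ∀ y, ∫ t in Icc (0 : ℝ) 1, ((fderiv ℝ φ (y - t • ξ) ξ : ℝ) : ℂ) =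
        (φ y : ℂ) - (φ (y - ξ) : ℂ) := by
      intro y
      have h5 : ∀ t : ℝ, HasDerivAt (fun t : ℝ => φ (y - t • ξ)) (-(fderiv ℝ φ (y - t • ξ) ξ)) t := by
        intro t
        have h6 : HasDerivAt (fun t : ℝ => y - t • ξ) (-ξ) t := by
          simpa using ((hasDerivAt_id t).smul_const ξ).const_sub y
        have h7 := ((h1.differentiable (by simp)) (y - t • ξ)).hasFDerivAt.comp_hasDerivAt t h6
        rw [map_neg] at h7
        exact h7
      have h8 := intervalIntegral.integral_eq_sub_of_hasDerivAt (a := 0) (b := 1)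
        (fun t _ => h5 t) (Continuous.intervalIntegrable (by fun_prop) _ _)
      rw [intervalIntegral.integral_of_le zero_le_one, ← integral_Icc_eq_integral_Ioc,
        integral_neg] at h8
      rw [integral_complex_ofReal, ← Complex.ofReal_sub]
      congr 1
      simp only [one_smul, zero_smul, sub_zero] at h8
      linarith
    have hprod' : Integrable (fun z : ℝ × Space d =>
        f z.2 * ((fderiv ℝ φ (z.2 - z.1 • ξ) ξ : ℝ) : ℂ))
        ((volume.restrict (Icc (0 : ℝ) 1)).prod volume) := by
      refine (hfi.comp_snd (volume.restrict (Icc (0 : ℝ) 1))).mul_bdd (c := B') ?_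
        (Eventually.of_forall fun z => ?_)
      · exact (Complex.continuous_ofReal.comp
          (hψc.comp (by fun_prop : Continuous fun z : ℝ × Space d =>
            z.2 - z.1 • ξ))).aestronglyMeasurable
      · simpa using hB' (z.2 - z.1 • ξ)
    have hseg : ∫ x, (∫ t in Icc (0 : ℝ) 1, dirDeriv v ξ (x + t • ξ)) * (φ x : ℂ) =
        -∫ y, f y * ((φ y : ℂ) - (φ (y - ξ) : ℂ)) := by
      have hpφ : Integrable (fun z : Space d × ℝ =>
          dirDeriv v ξ (z.1 + z.2 • ξ) * (φ z.1 : ℂ))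
          (volume.prod (volume.restrict (Icc (0 : ℝ) 1))) := by
        refine hprod.mul_bdd (c := B) (Complex.continuous_ofReal.comp
          (h1.continuous.comp continuous_fst)).aestronglyMeasurable
          (Eventually.of_forall fun z => ?_)
        simpa using hB z.1
      calc _ = ∫ x, ∫ t in Icc (0 : ℝ) 1, dirDeriv v ξ (x + t • ξ) * (φ x : ℂ) := by
            simp only [integral_mul_const]
        _ = ∫ t in Icc (0 : ℝ) 1, ∫ x, dirDeriv v ξ (x + t • ξ) * (φ x : ℂ) :=
            integral_integral_swap hpφ
        _ = ∫ t in Icc (0 : ℝ) 1, -∫ y, f y * ((fderiv ℝ φ (y - t • ξ) ξ : ℝ) : ℂ) :=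
            setIntegral_congr_fun measurableSet_Icc hderiv
        _ = -∫ y, ∫ t in Icc (0 : ℝ) 1, f y * ((fderiv ℝ φ (y - t • ξ) ξ : ℝ) : ℂ) := by
            rw [integral_neg, integral_integral_swap hprod']
        _ = _ := by simp only [integral_const_mul, hFTC]
    have hφ0 : ∀ {g : Space d → ℂ}, Integrable g → Integrable fun x => g x * (φ x : ℂ) := by
      intro g hg
      simpa using hmulφ 0 hg
    have hshift : ∫ x, f (x + ξ) * (φ x : ℂ) = ∫ y, f y * (φ (y - ξ) : ℂ) := by
      rw [← integral_add_right_eq_self (fun y => f y * (φ (y - ξ) : ℂ)) ξ]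
      simp
    calc ∫ x, φ x • (f (x + ξ) - f x - ∫ t in Icc (0 : ℝ) 1, dirDeriv v ξ (x + t • ξ))
        = ∫ x, (f (x + ξ) * (φ x : ℂ) - f x * (φ x : ℂ) -
            (∫ t in Icc (0 : ℝ) 1, dirDeriv v ξ (x + t • ξ)) * (φ x : ℂ)) := by
          congr 1 with x
          rw [Complex.real_smul]
          ring
      _ = (∫ y, f y * (φ (y - ξ) : ℂ)) - (∫ x, f x * (φ x : ℂ)) +
            ∫ y, f y * ((φ y : ℂ) - (φ (y - ξ) : ℂ)) := by
          have h9 : Integrable fun x => f (x + ξ) * (φ x : ℂ) - f x * (φ x : ℂ) :=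
            (hφ0 (hfi.comp_add_right ξ)).sub (hφ0 hfi)
          have h10 : Integrable fun x =>
              (∫ t in Icc (0 : ℝ) 1, dirDeriv v ξ (x + t • ξ)) * (φ x : ℂ) :=
            hφ0 hprod.integral_prod_left
          rw [integral_sub h9 h10, integral_sub (hφ0 (hfi.comp_add_right ξ)) (hφ0 hfi),
            hshift, hseg, sub_neg_eq_add]
      _ = 0 := by
          simp only [mul_sub]
          rw [integral_sub (hφ0 hfi) (hmulφ ξ hfi)]
          ring)
  filter_upwards [key] with x hx hx1 hx2
  exact sub_eq_zero.1 (hx ⟨hx1, hx2⟩)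

theorem lintegral_enorm_sq_translate_sub_le (hΩ : Bornology.IsBounded (Ω : Set (Space d)))
    (hconv : Convex ℝ (Ω : Set (Space d))) (v : H1 Ω) (ξ : Space d) :
    ∫⁻ x in (Ω : Set (Space d)) ∩ (fun x => x + ξ) ⁻¹' (Ω : Set (Space d)),
        ‖zeroExt (toL2 Ω v) (x + ξ) - zeroExt (toL2 Ω v) x‖ₑ ^ 2 ≤
      ‖ξ‖ₑ ^ 2 * ENNReal.ofReal (∑ i, ‖grad v i‖ ^ 2) := by
  have hUm : MeasurableSet ((Ω : Set (Space d)) ∩ (fun x => x + ξ) ⁻¹' (Ω : Set (Space d))) :=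
    (Ω.isOpen.inter (Ω.isOpen.preimage (by fun_prop))).measurableSet
  have hm : Measurable fun z : Space d × ℝ => ‖dirDeriv v ξ (z.1 + z.2 • ξ)‖ₑ ^ 2 :=
    (((stronglyMeasurable_dirDeriv v ξ).measurable.comp
      (by fun_prop : Measurable fun z : Space d × ℝ => z.1 + z.2 • ξ)).enorm).pow_const 2
  calc _ ≤ ∫⁻ x in (Ω : Set (Space d)) ∩ (fun x => x + ξ) ⁻¹' (Ω : Set (Space d)),
        ∫⁻ t in Icc (0 : ℝ) 1, ‖dirDeriv v ξ (x + t • ξ)‖ₑ ^ 2 := by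
        refine setLIntegral_mono_ae' hUm ?_
        filter_upwards [zeroExt_add_sub_eq_integral hΩ hconv v ξ] with x hx hxU
        rw [hx hxU.1 hxU.2]
        refine (pow_le_pow_left' (enorm_integral_le_lintegral_enorm _) 2).trans ?_
        refine (sq_lintegral_le _ ?_).trans_eq ?_
        · exact (((stronglyMeasurable_dirDeriv v ξ).measurable.comp
            (by fun_prop : Measurable fun t : ℝ => x + t • ξ)).enorm).aemeasurable
        · simp
    _ ≤ ∫⁻ x, ∫⁻ t in Icc (0 : ℝ) 1, ‖dirDeriv v ξ (x + t • ξ)‖ₑ ^ 2 :=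
        setLIntegral_le_lintegral _ _
    _ = ∫⁻ t in Icc (0 : ℝ) 1, ∫⁻ x, ‖dirDeriv v ξ (x + t • ξ)‖ₑ ^ 2 :=
        lintegral_lintegral_swap hm.aemeasurable
    _ = ∫⁻ x, ‖dirDeriv v ξ x‖ₑ ^ 2 := by
        have h1 : ∀ t : ℝ, ∫⁻ x, ‖dirDeriv v ξ (x + t • ξ)‖ₑ ^ 2 =
            ∫⁻ x, ‖dirDeriv v ξ x‖ₑ ^ 2 := fun t =>
          lintegral_add_right_eq_self (fun x => ‖dirDeriv v ξ x‖ₑ ^ 2) (t • ξ)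
        simp [h1]
    _ ≤ _ := lintegral_enorm_sq_dirDeriv_le v ξ

/-- The mean oscillation at scale `r` of an `H¹` function on a convex domain is controlled by its
gradient; the substitution `y = x + ξ` reduces this to the estimate for a fixed translation. -/
theorem lintegral_lintegral_enorm_sq_sub_le (hΩ : Bornology.IsBounded (Ω : Set (Space d)))
    (hconv : Convex ℝ (Ω : Set (Space d))) (v : H1 Ω) (r : ℝ) :
    ∫⁻ x in Ω, ∫⁻ y in (Ω : Set (Space d)) ∩ Metric.closedBall x r,
        ‖zeroExt (toL2 Ω v) y - zeroExt (toL2 Ω v) x‖ₑ ^ 2 ≤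
      volume (Metric.closedBall (0 : Space d) r) *
        (ENNReal.ofReal (r ^ 2) * ENNReal.ofReal (∑ i, ‖grad v i‖ ^ 2)) := by
  set f := zeroExt (toL2 Ω v)
  have hfm : Measurable f := (stronglyMeasurable_zeroExt _).measurable
  let k : Space d → Space d → ℝ≥0∞ := fun ξ x =>
    ((Ω : Set (Space d)) ∩ (fun x => x + ξ) ⁻¹' (Ω : Set (Space d))).indicator
      (fun x => ‖f (x + ξ) - f x‖ₑ ^ 2) x
  have hkm : Measurable fun z : Space d × Space d => k z.2 z.1 := by
    have hs : MeasurableSet {z : Space d × Space d | z.1 ∈ (Ω : Set (Space d)) ∧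
        z.1 + z.2 ∈ (Ω : Set (Space d))} :=
      ((Ω.isOpen.preimage continuous_fst).inter
        (Ω.isOpen.preimage (continuous_fst.add continuous_snd))).measurableSet
    have hg : Measurable fun z : Space d × Space d => ‖f (z.1 + z.2) - f z.1‖ₑ ^ 2 :=
      ((hfm.comp (measurable_fst.add measurable_snd)).sub
        (hfm.comp measurable_fst)).enorm.pow_const 2
    exact hg.indicator hs
  calc _ = ∫⁻ x in Ω, ∫⁻ ξ in Metric.closedBall (0 : Space d) r, k ξ x := by
        refine setLIntegral_congr_fun Ω.isOpen.measurableSet fun x hx => ?_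
        rw [← lintegral_indicator (Ω.isOpen.measurableSet.inter
            Metric.isClosed_closedBall.measurableSet),
          ← lintegral_indicator Metric.isClosed_closedBall.measurableSet,
          ← lintegral_add_left_eq_self _ x]
        congr 1 with ξ
        have h1 : x ∈ (Ω : Set (Space d)) := hx
        by_cases h2 : ξ ∈ Metric.closedBall (0 : Space d) r <;>
          by_cases h3 : x + ξ ∈ (Ω : Set (Space d)) <;>
          simp_all [k, indicator]
    _ ≤ ∫⁻ x, ∫⁻ ξ in Metric.closedBall (0 : Space d) r, k ξ x := setLIntegral_le_lintegral _ _
    _ = ∫⁻ ξ in Metric.closedBall (0 : Space d) r, ∫⁻ x, k ξ x :=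
        lintegral_lintegral_swap hkm.aemeasurable
    _ ≤ ∫⁻ ξ in Metric.closedBall (0 : Space d) r,
          ENNReal.ofReal (r ^ 2) * ENNReal.ofReal (∑ i, ‖grad v i‖ ^ 2) := by
        refine setLIntegral_mono' Metric.isClosed_closedBall.measurableSet fun ξ hξ => ?_
        have hUm : MeasurableSet
            ((Ω : Set (Space d)) ∩ (fun x => x + ξ) ⁻¹' (Ω : Set (Space d))) :=
          (Ω.isOpen.inter (Ω.isOpen.preimage (by fun_prop))).measurableSet
        rw [lintegral_indicator hUm]
        refine (lintegral_enorm_sq_translate_sub_le hΩ hconv v ξ).trans ?_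
        gcongr
        rw [← ofReal_norm, ← ENNReal.ofReal_pow (norm_nonneg _)]
        exact ENNReal.ofReal_le_ofReal
          (pow_le_pow_left₀ (norm_nonneg _) (mem_closedBall_zero_iff.1 hξ) 2)
    _ = _ := by
        rw [setLIntegral_const, mul_comm]

end GinzburgLandau

/-! ### Approximation by finite elements -/

namespace GinzburgLandau

theorem measure_mul_enorm_sq_integral_cond_sub_le {α : Type*} [MeasurableSpace α]
    {μ : Measure α} {s : Set α} (h0 : μ s ≠ 0) (htop : μ s ≠ ∞) {f : α → ℂ}
    (hf : Integrable f μ) (a : ℂ) :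
    μ s * ‖(∫ y, f y ∂(ProbabilityTheory.cond μ s)) - a‖ₑ ^ 2 ≤ ∫⁻ y in s, ‖f y - a‖ₑ ^ 2 ∂μ := by
  have hP := ProbabilityTheory.cond_isProbabilityMeasure_of_finite h0 htop
  have hfP : Integrable f (ProbabilityTheory.cond μ s) :=
    hf.integrableOn.smul_measure (ENNReal.inv_ne_top.2 h0)
  have h1 : (∫ y, f y ∂(ProbabilityTheory.cond μ s)) - a =
      ∫ y, (f y - a) ∂(ProbabilityTheory.cond μ s) := by
    rw [integral_sub hfP (integrable_const a)]
    simp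
  have h2 : ‖(∫ y, f y ∂(ProbabilityTheory.cond μ s)) - a‖ₑ ^ 2 ≤
      ∫⁻ y, ‖f y - a‖ₑ ^ 2 ∂(ProbabilityTheory.cond μ s) := by
    rw [h1]
    refine (pow_le_pow_left' (enorm_integral_le_lintegral_enorm _) 2).trans ?_
    refine (sq_lintegral_le _ (hfP.sub (integrable_const a)).aestronglyMeasurable.enorm).trans_eq ?_
    simp
  calc _ ≤ μ s * ∫⁻ y, ‖f y - a‖ₑ ^ 2 ∂(ProbabilityTheory.cond μ s) := by gcongr
    _ = _ := by
      rw [ProbabilityTheory.cond, lintegral_smul_measure, smul_eq_mul, ← mul_assoc,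
        ENNReal.mul_inv_cancel h0 htop, one_mul]

variable {d : ℕ} {Ω : TopologicalSpace.Opens (Space d)}

theorem coeFn_sub_L2 (u v : L2 Ω) :
    ∀ᵐ x ∂(volume.restrict (Ω : Set (Space d))), (u - v : L2 Ω) x = u x - v x :=
  Lp.coeFn_sub u v

namespace Triangulation

theorem diam_le_meshSize (𝒯 : Triangulation Ω) {T : Finset (Space d)} (hT : T ∈ 𝒯.cells) :
    Metric.diam (convexHull ℝ (T : Set (Space d))) ≤ 𝒯.meshSize :=
  le_ciSup (f := fun T : 𝒯.cells =>
    Metric.diam (convexHull ℝ ((T : Finset (Space d)) : Set (Space d))))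
    (Set.finite_range _).bddAbove ⟨T, hT⟩

theorem meshSize_nonneg (𝒯 : Triangulation Ω) : 0 ≤ 𝒯.meshSize :=
  Real.iSup_nonneg fun _ => Metric.diam_nonneg

/-- Near every vertex of the mesh there is a ball in `Ω` of radius comparable to the mesh size: an
inscribed ball of a cell at that vertex. Absolute values of `σ` and `τ` dispense with sign
conditions. -/
theorem exists_ball_near_vertex (𝒯 : Triangulation Ω) (hΩ : IsConvexPolytope Ω) {σ τ : ℝ}
    (hσ : 𝒯.IsShapeRegular σ) (hτ : 𝒯.IsQuasiUniform τ) {T : Finset (Space d)}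
    (hT : T ∈ 𝒯.cells) {z : Space d} (hz : z ∈ T) :
    ∃ (x : Space d) (r : ℝ), 0 < r ∧ Metric.ball x r ⊆ (Ω : Set (Space d)) ∧
      Metric.ball x r ⊆ Metric.closedBall z 𝒯.meshSize ∧
      volume (Metric.closedBall (0 : Space d) (2 * 𝒯.meshSize)) ≤
        ENNReal.ofReal ((4 * (|σ| * |τ|)) ^ d) * volume (Metric.ball x r) := by
  obtain ⟨x, ρ, hρ, hball, hdiam⟩ := hσ T hT
  have hb : Metric.ball x (ρ / 2) ⊆ convexHull ℝ (T : Set (Space d)) :=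
    Metric.ball_subset_closedBall.trans hball
  have hh : 𝒯.meshSize ≤ 2 * (|σ| * |τ|) * (ρ / 2) := by
    calc 𝒯.meshSize ≤ τ * Metric.diam (convexHull ℝ (T : Set (Space d))) := hτ T hT
      _ ≤ |τ| * Metric.diam (convexHull ℝ (T : Set (Space d))) := by
          gcongr
          exact le_abs_self τ
      _ ≤ |τ| * (|σ| * ρ) := by
          gcongr
          exact hdiam.trans (mul_le_mul_of_nonneg_right (le_abs_self σ) hρ.le)
      _ = 2 * (|σ| * |τ|) * (ρ / 2) := by ring
  refine ⟨x, ρ / 2, by positivity, ?_, ?_, ?_⟩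
  · rw [← hΩ.interior_closure]
    refine interior_maximal (hb.trans ?_) Metric.isOpen_ball
    rw [← 𝒯.cover]
    exact subset_biUnion_of_mem (u := fun T : Finset (Space d) =>
      convexHull ℝ (T : Set (Space d))) hT
  · intro y hy
    exact (Metric.dist_le_diam_of_mem (isBounded_cell T) (hb hy)
      (subset_convexHull ℝ _ hz)).trans (𝒯.diam_le_meshSize hT)
  · calc volume (Metric.closedBall (0 : Space d) (2 * 𝒯.meshSize))
        ≤ volume (Metric.closedBall (0 : Space d) (4 * (|σ| * |τ|) * (ρ / 2))) :=
          measure_mono (Metric.closedBall_subset_closedBall (by linarith))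
      _ = _ := by
          rw [Measure.addHaar_closedBall_mul volume (0 : Space d)
              (by positivity : 0 ≤ 4 * (|σ| * |τ|)) (by positivity : 0 ≤ ρ / 2),
            finrank_euclideanSpace_fin,
            Measure.addHaar_closedBall volume _ (by positivity : 0 ≤ ρ / 2),
            ← Measure.addHaar_ball_of_pos volume x (by positivity : 0 < ρ / 2)]

set_option maxHeartbeats 400000 in
/-- First-order approximation in `L²` by finite elements. The nodal value at a vertex is the mean
of `w` over a ball of radius `≳ h` at distance `≲ h`; since the values of the interpolant are
convex combinations of nodal values, its error at `x` is at most the mean oscillation of `w`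
around `x` at scale `2 h`. -/
theorem exists_mem_Vh_norm_sub_sq_le (𝒯 : Triangulation Ω) (hΩ : IsConvexPolytope Ω) {σ τ : ℝ}
    (hσ : 𝒯.IsShapeRegular σ) (hτ : 𝒯.IsQuasiUniform τ) (w : H1 Ω) :
    ∃ v ∈ 𝒯.Vh, ‖toL2 Ω v - toL2 Ω w‖ ^ 2 ≤
      (4 * (|σ| * |τ|)) ^ d * (2 * 𝒯.meshSize) ^ 2 * ∑ i, ‖grad w i‖ ^ 2 := by
  set h := 𝒯.meshSize
  have hh0 : 0 ≤ h := 𝒯.meshSize_nonneg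
  set f := zeroExt (toL2 Ω w) with hf
  have hfi : Integrable f := integrable_zeroExt hΩ.isBounded _
  set L : ℝ := 4 * (|σ| * |τ|)
  have hballs : ∀ z : Space d, ∃ (x : Space d) (r : ℝ), (∃ T ∈ 𝒯.cells, z ∈ T) → 0 < r ∧
      Metric.ball x r ⊆ (Ω : Set (Space d)) ∧
      Metric.ball x r ⊆ Metric.closedBall z h ∧ volume (Metric.closedBall (0 : Space d) (2 * h)) ≤
        ENNReal.ofReal (L ^ d) * volume (Metric.ball x r) := by
    intro z
    by_cases hz : ∃ T ∈ 𝒯.cells, z ∈ T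
    · obtain ⟨T, hT, hzT⟩ := hz
      obtain ⟨x, r, hxr⟩ := 𝒯.exists_ball_near_vertex hΩ hσ hτ hT hzT
      exact ⟨x, r, fun _ => hxr⟩
    · exact ⟨0, 0, fun h => absurd h hz⟩
  clear_value f
  choose c r hyr using hballs
  obtain ⟨m, hm⟩ : ∃ m : Space d → ℂ, ∀ z,
      m z = ∫ y, f y ∂(ProbabilityTheory.cond volume (Metric.ball (c z) (r z))) :=
    ⟨_, fun _ => rfl⟩
  obtain ⟨v, hv, hvae⟩ := 𝒯.exists_mem_Vh_forall_mem_convexHull hΩ m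
  refine ⟨v, hv, ?_⟩
  have hpt : ∀ᵐ x ∂(volume.restrict (Ω : Set (Space d))),
      volume (Metric.closedBall (0 : Space d) (2 * h)) * ‖(toL2 Ω v - toL2 Ω w : L2 Ω) x‖ₑ ^ 2 ≤
        ENNReal.ofReal (L ^ d) *
          ∫⁻ y in (Ω : Set (Space d)) ∩ Metric.closedBall x (2 * h), ‖f y - f x‖ₑ ^ 2 := by
    filter_upwards [hvae, coeFn_sub_L2 (toL2 Ω v) (toL2 Ω w),
      ae_restrict_mem Ω.isOpen.measurableSet] with x hxe hsub hxΩ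
    obtain ⟨T, hT, hxT, hx⟩ := hxe
    obtain ⟨_, ⟨z, hz, rfl⟩, hdist⟩ := convexHull_exists_dist_ge hx (f x)
    obtain ⟨hr, hBΩ, hBz, hvol⟩ := hyr z ⟨T, hT, hz⟩
    have hfx : toL2 Ω w x = f x := by
      rw [hf, zeroExt, indicator_of_mem hxΩ]
    rw [hsub, hfx]
    have hle : ‖toL2 Ω v x - f x‖ₑ ≤
        ‖m z - f x‖ₑ := by
      rw [dist_eq_norm, dist_eq_norm] at hdist
      simpa only [← ofReal_norm] using ENNReal.ofReal_le_ofReal hdist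
    have hBx : Metric.ball (c z) (r z) ⊆
        (Ω : Set (Space d)) ∩ Metric.closedBall x (2 * h) := by
      refine fun a ha => ⟨hBΩ ha, ?_⟩
      have h1 : dist a z ≤ h := hBz ha
      have h2 : dist z x ≤ h := (Metric.dist_le_diam_of_mem (isBounded_cell T)
        (subset_convexHull ℝ _ hz) hxT).trans (𝒯.diam_le_meshSize hT)
      rw [Metric.mem_closedBall]
      linarith [dist_triangle a z x]
    calc _ ≤ ENNReal.ofReal (L ^ d) * volume (Metric.ball (c z) (r z)) *
          ‖m z - f x‖ₑ ^ 2 := by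
          gcongr
      _ ≤ ENNReal.ofReal (L ^ d) *
          ∫⁻ y in Metric.ball (c z) (r z), ‖f y - f x‖ₑ ^ 2 := by
          rw [mul_assoc]
          gcongr
          rw [hm]
          exact measure_mul_enorm_sq_integral_cond_sub_le
            (Metric.measure_ball_pos volume _ hr).ne' measure_ball_lt_top.ne hfi _
      _ ≤ _ := by gcongr
  -- The ball of radius `2 h` contains one of the balls used for the means, so it is not null.
  have hpos : volume (Metric.closedBall (0 : Space d) (2 * h)) ≠ 0 := by
    obtain ⟨x, hx⟩ := hΩ.1
    have hxc : x ∈ ⋃ T ∈ 𝒯.cells, convexHull ℝ (T : Set (Space d)) := by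
      rw [𝒯.cover]
      exact subset_closure hx
    obtain ⟨T, hT, hxT⟩ := mem_iUnion₂.1 hxc
    obtain ⟨z, hz⟩ : (T : Set (Space d)).Nonempty := convexHull_nonempty_iff.1 ⟨x, hxT⟩
    obtain ⟨hr, -, hBz, -⟩ := hyr z ⟨T, hT, hz⟩
    have h1 : 0 < volume (Metric.closedBall z h) :=
      (Metric.measure_ball_pos volume (c z) hr).trans_le (measure_mono hBz)
    rw [Measure.addHaar_closedBall_center] at h1
    exact (h1.trans_le (measure_mono (Metric.closedBall_subset_closedBall (by linarith)))).ne'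
  have hint := lintegral_mono_ae hpt
  rw [hf] at hint
  rw [lintegral_const_mul' _ _ measure_closedBall_lt_top.ne,
    lintegral_const_mul' _ _ ENNReal.ofReal_ne_top, setLIntegral_enorm_sq] at hint
  have hfin := hint.trans (mul_le_mul_right
    (lintegral_lintegral_enorm_sq_sub_le hΩ.isBounded hΩ.convex w (2 * h)) _)
  rw [mul_left_comm, ENNReal.mul_le_mul_iff_right hpos measure_closedBall_lt_top.ne,
    ← ENNReal.ofReal_mul (by positivity), ← ENNReal.ofReal_mul (by positivity),
    ENNReal.ofReal_le_ofReal_iff (by positivity), ← mul_assoc] at hfin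
  exact hfin

end Triangulation

end GinzburgLandau

/-! ### The magnetic form and the corrector -/

namespace GinzburgLandau

/-- Ritz projection onto a closed subspace along a form that is coercive there (Lax–Milgram). -/
theorem exists_continuousLinearMap_iff_galerkin {H : Type*} [NormedAddCommGroup H]
    [InnerProductSpace ℝ H] [CompleteSpace H] (a : H →L[ℝ] H →L[ℝ] ℝ) {W : Submodule ℝ H}
    (hW : IsClosed (W : Set H)) {c : ℝ} (hc : 0 < c)
    (ha : ∀ w ∈ W, c * ‖w‖ ^ 2 ≤ a w w) :
    ∃ C : H →L[ℝ] W, ∀ v u : H, (u ∈ W ∧ ∀ w ∈ W, a u w = a v w) ↔ u = C v := by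
  have : CompleteSpace W := hW.completeSpace_coe
  have hB : IsCoercive (a.bilinearComp W.subtypeL W.subtypeL) :=
    ⟨c, hc, fun w => by simpa [sq, mul_assoc] using ha w w.2⟩
  let P : H →L[ℝ] H := InnerProductSpace.continuousLinearMapOfBilin (𝕜 := ℝ) a
  let C : H →L[ℝ] W := hB.continuousLinearEquivOfBilin.symm.toContinuousLinearMap.comp
    (W.orthogonalProjectionOnto.comp P)
  have hC : ∀ v : H, hB.continuousLinearEquivOfBilin (C v) = W.orthogonalProjectionOnto (P v) :=
    fun v => ContinuousLinearEquiv.apply_symm_apply _ _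
  have hproj : ∀ (v : H) (w : W), inner ℝ (W.orthogonalProjectionOnto (P v)) w = a v w := by
    intro v w
    refine (Submodule.inner_orthogonalProjectionOnto_eq_of_mem_right w (P v)).trans ?_
    exact InnerProductSpace.continuousLinearMapOfBilin_apply (𝕜 := ℝ) a v w
  have happ : ∀ u w : W, inner ℝ (hB.continuousLinearEquivOfBilin u) w = a u w := fun u w =>
    hB.continuousLinearEquivOfBilin_apply u w
  refine ⟨C, fun v u => ⟨?_, ?_⟩⟩
  · rintro ⟨hu, huw⟩
    have h1 : hB.continuousLinearEquivOfBilin ⟨u, hu⟩ =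
        hB.continuousLinearEquivOfBilin (C v) := by
      rw [hC]
      refine ext_inner_right ℝ fun w => ?_
      rw [happ, hproj]
      exact huw w w.2
    exact congrArg Subtype.val (hB.continuousLinearEquivOfBilin.injective h1)
  · rintro rfl
    refine ⟨(C v).2, fun w hw => ?_⟩
    rw [← hproj v ⟨w, hw⟩, ← hC, happ]

variable {d : ℕ} {Ω : TopologicalSpace.Opens (Space d)}

theorem l2Inner_eq_inner (f g : L2 Ω) : l2Inner f g = inner ℝ f g := by
  have hint : Integrable (fun x => f x * (starRingEnd ℂ) (g x))
      (volume.restrict (Ω : Set (Space d))) :=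
    (Lp.memLp f).integrable_mul (Lp.memLp g).star
  rw [L2.inner_def, l2Inner]
  refine (integral_re hint).symm.trans (integral_congr_ae ?_)
  refine Eventually.of_forall fun x => ?_
  simp [Complex.inner]
  ring

/-- The embedding `H¹(Ω) → L²(Ω)` as a continuous linear map. -/
noncomputable def toL2L (Ω : TopologicalSpace.Opens (Space d)) : H1 Ω →L[ℝ] L2 Ω :=
  (WithLp.fstL 2 ℝ (L2 Ω) (PiLp 2 (fun _ : Fin d => L2 Ω))).comp (H1 Ω).subtypeL

/-- The weak partial derivative `∂ᵢ` as a continuous linear map `H¹(Ω) → L²(Ω)`. -/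
noncomputable def gradL (Ω : TopologicalSpace.Opens (Space d)) (i : Fin d) : H1 Ω →L[ℝ] L2 Ω :=
  ((PiLp.proj 2 (fun _ : Fin d => L2 Ω) i : _ →L[ℝ] L2 Ω).comp
    (WithLp.sndL 2 ℝ (L2 Ω) (PiLp 2 (fun _ : Fin d => L2 Ω)))).comp (H1 Ω).subtypeL

theorem toL2L_apply (v : H1 Ω) : toL2L Ω v = toL2 Ω v := rfl

theorem norm_sq_eq_H1 (v : H1 Ω) : ‖v‖ ^ 2 = ‖toL2 Ω v‖ ^ 2 + ∑ i, ‖grad v i‖ ^ 2 := by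
  rw [Submodule.coe_norm, WithLp.prod_norm_sq_eq_of_L2, PiLp.norm_sq_eq_of_L2]
  rfl

theorem continuous_integral_mul_ofReal {ψ : Space d → ℝ}
    (hψ : MemLp (fun x => (ψ x : ℂ)) 2 (volume.restrict (Ω : Set (Space d)))) :
    Continuous fun u : L2 Ω => ∫ x in Ω, u x * (ψ x : ℂ) := by
  have h : ∀ u : L2 Ω, ∫ x in Ω, u x * (ψ x : ℂ) = inner ℂ (hψ.toLp _) u := by
    intro u
    rw [L2.inner_def]
    refine integral_congr_ae ?_
    filter_upwards [hψ.coeFn_toLp] with x hx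
    rw [hx]
    simp
  simp only [h]
  fun_prop

/-- `H¹(Ω)` is complete: the identities that define weak derivatives are closed conditions. -/
theorem isClosed_H1 (Ω : TopologicalSpace.Opens (Space d)) : IsClosed (H1 Ω : Set (L2Jet Ω)) := by
  have h : (H1 Ω : Set (L2Jet Ω)) = ⋂ (i : Fin d) (φ : Space d → ℝ) (_ : IsTestFunction Ω φ),
      {v : L2Jet Ω | ∫ x in Ω, (v.fst : L2 Ω) x * (partialDeriv i φ x : ℂ) =
        -∫ x in Ω, (v.snd i : L2 Ω) x * (φ x : ℂ)} := by
    ext v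
    simp only [mem_iInter]
    rfl
  rw [h]
  refine isClosed_iInter fun i => isClosed_iInter fun φ => isClosed_iInter fun hφ => ?_
  refine isClosed_eq ?_ ?_
  · exact (continuous_integral_mul_ofReal (hφ.memLp_partialDeriv i)).comp
      (WithLp.fstL 2 ℝ (L2 Ω) (PiLp 2 (fun _ : Fin d => L2 Ω))).continuous
  · exact ((continuous_integral_mul_ofReal hφ.memLp).comp
      ((PiLp.proj 2 (fun _ : Fin d => L2 Ω) i : _ →L[ℝ] L2 Ω).comp
        (WithLp.sndL 2 ℝ (L2 Ω) (PiLp 2 (fun _ : Fin d => L2 Ω)))).continuous).neg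

instance completeSpace_H1 (Ω : TopologicalSpace.Opens (Space d)) : CompleteSpace (H1 Ω) :=
  (isClosed_H1 Ω).completeSpace_coe

/-- Multiplication by a bounded function on `L²(Ω)`. -/
noncomputable def mulL (α : Lp ℂ ∞ (volume.restrict (Ω : Set (Space d)))) : L2 Ω →L[ℝ] L2 Ω :=
  (ContinuousLinearMap.mul ℝ ℂ).holderL (volume.restrict (Ω : Set (Space d))) ∞ 2 2 α

theorem coeFn_mulL (α : Lp ℂ ∞ (volume.restrict (Ω : Set (Space d)))) (u : L2 Ω) :
    ∀ᵐ x ∂(volume.restrict (Ω : Set (Space d))), mulL α u x = α x * u x :=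
  (ContinuousLinearMap.mul ℝ ℂ).coeFn_holder (r := 2) α u

theorem norm_mulL_le (α : Lp ℂ ∞ (volume.restrict (Ω : Set (Space d)))) (u : L2 Ω) :
    ‖mulL α u‖ ≤ ‖α‖ * ‖u‖ := by
  refine ((ContinuousLinearMap.mul ℝ ℂ).norm_holder_apply_apply_le (r := 2) α u).trans ?_
  have := ContinuousLinearMap.opNorm_mul_le ℝ ℂ
  gcongr
  exact mul_le_of_le_one_left (norm_nonneg _) this

theorem memLp_coord {A : Space d → Space d}
    (hA : MemLp A ∞ (volume.restrict (Ω : Set (Space d)))) (i : Fin d) :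
    MemLp (fun x => (A x i : ℂ)) ∞ (volume.restrict (Ω : Set (Space d))) := by
  have h1 : MemLp (fun x => A x i) ∞ (volume.restrict (Ω : Set (Space d))) :=
    (EuclideanSpace.proj (𝕜 := ℝ) i).comp_memLp' hA
  exact h1.ofReal

/-- The component `Aᵢ` of a bounded vector field as an element of `L^∞(Ω; ℂ)`. -/
noncomputable def coordLp {A : Space d → Space d}
    (hA : MemLp A ∞ (volume.restrict (Ω : Set (Space d)))) (i : Fin d) :
    Lp ℂ ∞ (volume.restrict (Ω : Set (Space d))) :=
  (memLp_coord hA i).toLp _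

theorem coeFn_coordLp {A : Space d → Space d}
    (hA : MemLp A ∞ (volume.restrict (Ω : Set (Space d)))) (i : Fin d) :
    ∀ᵐ x ∂(volume.restrict (Ω : Set (Space d))), coordLp hA i x = (A x i : ℂ) :=
  (memLp_coord hA i).coeFn_toLp

/-- The `i`-th component of `v ↦ (i/κ) ∇v + A v` as a continuous linear map `H¹(Ω) → L²(Ω)`. -/
noncomputable def magGradL {A : Space d → Space d}
    (hA : MemLp A ∞ (volume.restrict (Ω : Set (Space d)))) (κ : ℝ) (i : Fin d) :
    H1 Ω →L[ℝ] L2 Ω :=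
  (Complex.I / (κ : ℂ)) • gradL Ω i + (mulL (coordLp hA i)).comp (toL2L Ω)

theorem magGradL_apply {A : Space d → Space d}
    (hA : MemLp A ∞ (volume.restrict (Ω : Set (Space d)))) (κ : ℝ) (i : Fin d) (v : H1 Ω) :
    magGradL hA κ i v =
      (Complex.I / (κ : ℂ)) • grad v i + mulL (coordLp hA i) (toL2 Ω v) := rfl

theorem coeFn_magGradL {A : Space d → Space d}
    (hA : MemLp A ∞ (volume.restrict (Ω : Set (Space d)))) (κ : ℝ) (i : Fin d) (v : H1 Ω) :
    ∀ᵐ x ∂(volume.restrict (Ω : Set (Space d))), magGradL hA κ i v x = magGrad A κ v i x := by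
  rw [magGradL_apply]
  filter_upwards [Lp.coeFn_add ((Complex.I / (κ : ℂ)) • grad v i)
    (mulL (coordLp hA i) (toL2 Ω v)), Lp.coeFn_smul (Complex.I / (κ : ℂ)) (grad v i),
    coeFn_mulL (coordLp hA i) (toL2 Ω v), coeFn_coordLp hA i]
    with x h1 h2 h3 h4
  rw [h1, Pi.add_apply, h2, h3, h4]
  rfl

/-- The magnetic form `a_β` as a bounded bilinear form on `H¹(Ω)`. -/
noncomputable def aFormL {A : Space d → Space d}
    (hA : MemLp A ∞ (volume.restrict (Ω : Set (Space d)))) (κ β : ℝ) :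
    H1 Ω →L[ℝ] H1 Ω →L[ℝ] ℝ :=
  (∑ i, (innerSL ℝ (E := L2 Ω)).bilinearComp (magGradL hA κ i) (magGradL hA κ i)) +
    β • (innerSL ℝ (E := L2 Ω)).bilinearComp (toL2L Ω) (toL2L Ω)

theorem aFormL_apply {A : Space d → Space d}
    (hA : MemLp A ∞ (volume.restrict (Ω : Set (Space d)))) (κ β : ℝ) (v w : H1 Ω) :
    aFormL hA κ β v w = (∑ i, inner ℝ (magGradL hA κ i v) (magGradL hA κ i w)) +
      β * inner ℝ (toL2 Ω v) (toL2 Ω w) := by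
  simp [aFormL, toL2L_apply]

theorem re_integral_sum_mul_conj {ι : Type*} [Fintype ι] (f g : ι → L2 Ω) :
    (∫ x in Ω, ∑ i, f i x * (starRingEnd ℂ) (g i x)).re = ∑ i, inner ℝ (f i) (g i) := by
  have hint : ∀ i, Integrable (fun x => f i x * (starRingEnd ℂ) (g i x))
      (volume.restrict (Ω : Set (Space d))) := fun i =>
    (Lp.memLp (f i)).integrable_mul (Lp.memLp (g i)).star
  rw [integral_finsetSum _ fun i _ => hint i, Complex.re_sum]
  exact Finset.sum_congr rfl fun i _ => l2Inner_eq_inner (f i) (g i)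

theorem aForm_eq_of_ae_eq_magGrad {A : Space d → Space d} {κ β : ℝ} {v w : H1 Ω}
    {f g : Fin d → L2 Ω}
    (hf : ∀ i, ∀ᵐ x ∂(volume.restrict (Ω : Set (Space d))), f i x = magGrad A κ v i x)
    (hg : ∀ i, ∀ᵐ x ∂(volume.restrict (Ω : Set (Space d))), g i x = magGrad A κ w i x) :
    aForm A κ β v w = (∑ i, inner ℝ (f i) (g i)) + β * inner ℝ (toL2 Ω v) (toL2 Ω w) := by
  rw [aForm, l2Inner_eq_inner, ← re_integral_sum_mul_conj]
  congr 2
  refine integral_congr_ae ?_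
  filter_upwards [ae_all_iff.2 hf, ae_all_iff.2 hg] with x h1 h2
  exact Finset.sum_congr rfl fun i _ => by rw [h1, h2]

theorem aForm_eq_aFormL {A : Space d → Space d}
    (hA : MemLp A ∞ (volume.restrict (Ω : Set (Space d)))) (κ β : ℝ) (v w : H1 Ω) :
    aForm A κ β v w = aFormL hA κ β v w :=
  (aForm_eq_of_ae_eq_magGrad (fun i => coeFn_magGradL hA κ i v)
    fun i => coeFn_magGradL hA κ i w).trans (aFormL_apply hA κ β v w).symm

/-- The bound `∑ᵢ ‖Aᵢ‖²_{L^∞}` on the size of the vector potential. -/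
noncomputable def potentialBound {A : Space d → Space d}
    (hA : MemLp A ∞ (volume.restrict (Ω : Set (Space d)))) : ℝ :=
  ∑ i, ‖coordLp hA i‖ ^ 2

theorem potentialBound_nonneg {A : Space d → Space d}
    (hA : MemLp A ∞ (volume.restrict (Ω : Set (Space d)))) : 0 ≤ potentialBound hA :=
  Finset.sum_nonneg fun _ _ => sq_nonneg _

theorem exists_pos_mul_sq_le_quarter {Q : ℝ} (hQ : 0 ≤ Q) : ∃ c : ℝ, 0 < c ∧ Q * c ^ 2 ≤ 1 / 4 := by
  refine ⟨1 / (2 * (Q + 1)), by positivity, ?_⟩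
  rw [div_pow, one_pow, mul_one_div, div_le_iff₀ (by positivity)]
  nlinarith

theorem half_sq_sub_sq_le_norm_add_sq {E : Type*} [SeminormedAddCommGroup E] (a b : E) :
    1 / 2 * ‖a‖ ^ 2 - ‖b‖ ^ 2 ≤ ‖a + b‖ ^ 2 := by
  have h := norm_sub_le (a + b) b
  rw [add_sub_cancel_right] at h
  nlinarith [sq_nonneg (‖a + b‖ - ‖b‖), norm_nonneg a, norm_nonneg b, norm_nonneg (a + b)]

set_option maxHeartbeats 800000 in
/-- Gårding's inequality for the magnetic form. -/
theorem le_aForm_self {A : Space d → Space d}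
    (hA : MemLp A ∞ (volume.restrict (Ω : Set (Space d)))) (κ β : ℝ) (v : H1 Ω) :
    1 / 2 * (1 / κ ^ 2 * ∑ i, ‖grad v i‖ ^ 2) -
      potentialBound hA * ‖toL2 Ω v‖ ^ 2 + β * ‖toL2 Ω v‖ ^ 2 ≤
      aForm A κ β v v := by
  rw [aForm_eq_aFormL hA, aFormL_apply]
  simp only [real_inner_self_eq_norm_sq]
  have hI : ‖Complex.I / (κ : ℂ)‖ ^ 2 = 1 / κ ^ 2 := by
    simp
  have h : ∀ i, 1 / 2 * (1 / κ ^ 2 * ‖grad v i‖ ^ 2) -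
      ‖coordLp hA i‖ ^ 2 * ‖toL2 Ω v‖ ^ 2 ≤ ‖magGradL hA κ i v‖ ^ 2 := by
    intro i
    have h1 := half_sq_sub_sq_le_norm_add_sq ((Complex.I / (κ : ℂ)) • grad v i)
      (mulL (coordLp hA i) (toL2 Ω v))
    have h2 := pow_le_pow_left₀ (norm_nonneg _)
      (norm_mulL_le (coordLp hA i) (toL2 Ω v)) 2
    rw [norm_smul, mul_pow, hI] at h1
    rw [mul_pow] at h2
    rw [magGradL_apply]
    linarith
  have h3 := Finset.sum_le_sum fun i (_ : i ∈ Finset.univ) => h i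
  rw [potentialBound]
  rw [Finset.sum_sub_distrib, ← Finset.mul_sum, ← Finset.mul_sum, ← Finset.sum_mul] at h3
  linarith

namespace Triangulation

theorem mem_W_iff (𝒯 : Triangulation Ω) (w : H1 Ω) :
    w ∈ 𝒯.W ↔ 𝒯.VhL2.orthogonalProjectionOnto (toL2L Ω w) = 0 :=
  (𝒯.Vh.equivMapOfInjective (toL2 Ω) (toL2_injective Ω)).symm.map_eq_zero_iff

theorem isClosed_W (𝒯 : Triangulation Ω) : IsClosed (𝒯.W : Set (H1 Ω)) := by
  have h : (𝒯.W : Set (H1 Ω)) =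
      (fun w => 𝒯.VhL2.orthogonalProjectionOnto (toL2L Ω w)) ⁻¹' {0} := by
    ext w
    exact 𝒯.mem_W_iff w
  rw [h]
  exact isClosed_singleton.preimage
    (𝒯.VhL2.orthogonalProjectionOnto.continuous.comp (toL2L Ω).continuous)

/-- Functions in `W` are `L²`-orthogonal to `V_h`, so `0` is their best approximation in `V_h`. -/
theorem norm_toL2_sq_le_of_mem_W (𝒯 : Triangulation Ω) {w v : H1 Ω} (hw : w ∈ 𝒯.W)
    (hv : v ∈ 𝒯.Vh) : ‖toL2 Ω w‖ ^ 2 ≤ ‖toL2 Ω v - toL2 Ω w‖ ^ 2 := by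
  have hmem : toL2 Ω v ∈ 𝒯.VhL2 := ⟨v, hv, rfl⟩
  have h1 : toL2 Ω w ∈ 𝒯.VhL2ᗮ :=
    Submodule.orthogonalProjectionOnto_eq_zero_iff.1 ((𝒯.mem_W_iff w).1 hw)
  have h2 : inner ℝ (toL2 Ω v) (toL2 Ω w) = 0 := h1 _ hmem
  rw [norm_sub_sq_real, h2]
  linarith [sq_nonneg ‖toL2 Ω v‖]

/-- The scaled Poincaré inequality on the detail space `W`. -/
theorem norm_toL2_sq_le_meshSize_sq (𝒯 : Triangulation Ω) (hΩ : IsConvexPolytope Ω) {σ τ : ℝ}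
    (hσ : 𝒯.IsShapeRegular σ) (hτ : 𝒯.IsQuasiUniform τ) {w : H1 Ω} (hw : w ∈ 𝒯.W) :
    ‖toL2 Ω w‖ ^ 2 ≤
      4 * (4 * (|σ| * |τ|)) ^ d * 𝒯.meshSize ^ 2 * ∑ i, ‖grad w i‖ ^ 2 := by
  obtain ⟨v, hv, hvw⟩ := 𝒯.exists_mem_Vh_norm_sub_sq_le hΩ hσ hτ w
  refine ((𝒯.norm_toL2_sq_le_of_mem_W hw hv).trans hvw).trans_eq ?_
  ring

/-- Coercivity of the magnetic form on `W`, with squared Poincaré constant `P h²`, once the mesh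
size resolves the scale `κ⁻¹`: of the half of the gradient term that Gårding's inequality retains,
one half absorbs the zeroth-order terms. -/
theorem quarter_normH1κSq_le_aForm (𝒯 : Triangulation Ω) {A : Space d → Space d}
    (hA : MemLp A ∞ (volume.restrict (Ω : Set (Space d)))) {P c κ : ℝ} (hP0 : 0 ≤ P)
    (hP : ∀ w ∈ 𝒯.W, ‖toL2 Ω w‖ ^ 2 ≤ P * 𝒯.meshSize ^ 2 * ∑ i, ‖grad w i‖ ^ 2)
    (hc : P * (1 / 4 + potentialBound hA) * c ^ 2 ≤ 1 / 4) (hh : 𝒯.meshSize ≤ c * κ⁻¹)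
    (β : ℝ) {w : H1 Ω} (hw : w ∈ 𝒯.W) :
    1 / 4 * normH1κSq κ w + β * ‖toL2 Ω w‖ ^ 2 ≤ aForm A κ β w w := by
  have hM0 := potentialBound_nonneg hA
  have h1 := le_aForm_self hA κ β w
  have h2 := hP w hw
  rw [normH1κSq]
  have hG0 : 0 ≤ ∑ i, ‖grad w i‖ ^ 2 := Finset.sum_nonneg fun i _ => sq_nonneg _
  generalize ∑ i, ‖grad w i‖ ^ 2 = G at *
  generalize potentialBound hA = M at *
  have h3 : P * (1 / 4 + M) * 𝒯.meshSize ^ 2 ≤ 1 / 4 * (1 / κ ^ 2) := by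
    calc P * (1 / 4 + M) * 𝒯.meshSize ^ 2 ≤ P * (1 / 4 + M) * (c * κ⁻¹) ^ 2 := by
          have := 𝒯.meshSize_nonneg
          gcongr
      _ = P * (1 / 4 + M) * c ^ 2 * (1 / κ ^ 2) := by
          rw [mul_pow, inv_pow, one_div (κ ^ 2)]
          ring
      _ ≤ _ := by gcongr
  have h4 : (1 / 4 + M) * ‖toL2 Ω w‖ ^ 2 ≤ 1 / 4 * (1 / κ ^ 2 * G) := by
    calc (1 / 4 + M) * ‖toL2 Ω w‖ ^ 2 ≤ (1 / 4 + M) * (P * 𝒯.meshSize ^ 2 * G) := by gcongr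
      _ = P * (1 / 4 + M) * 𝒯.meshSize ^ 2 * G := by ring
      _ ≤ 1 / 4 * (1 / κ ^ 2) * G := by gcongr
      _ = _ := by ring
  linarith

theorem min_mul_norm_sq_le_normH1κSq (κ : ℝ) (v : H1 Ω) :
    min 1 (1 / κ ^ 2) * ‖v‖ ^ 2 ≤ normH1κSq κ v := by
  have hG0 : 0 ≤ ∑ i, ‖grad v i‖ ^ 2 := Finset.sum_nonneg fun i _ => sq_nonneg _
  rw [normH1κSq, norm_sq_eq_H1, mul_add]
  have h1 := mul_le_mul_of_nonneg_right (min_le_left 1 (1 / κ ^ 2)) (sq_nonneg ‖toL2 Ω v‖)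
  have h2 := mul_le_mul_of_nonneg_right (min_le_right 1 (1 / κ ^ 2)) hG0
  linarith

set_option maxHeartbeats 800000 in
theorem exists_corrector (𝒯 : Triangulation Ω) {A : Space d → Space d}
    (hA : MemLp A ∞ (volume.restrict (Ω : Set (Space d)))) {κ β : ℝ} (hκ : 0 < κ) (hβ : 0 ≤ β)
    (hcoer : ∀ w ∈ 𝒯.W, 1 / 4 * normH1κSq κ w + β * ‖toL2 Ω w‖ ^ 2 ≤ aForm A κ β w w) :
    ∃ C : H1 Ω →L[ℝ] 𝒯.W, ∀ v c : H1 Ω, 𝒯.IsCorrector A κ β v c ↔ c = C v := by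
  have hcoerL : ∀ w ∈ 𝒯.W, 1 / 4 * min 1 (1 / κ ^ 2) * ‖w‖ ^ 2 ≤ aFormL hA κ β w w := by
    intro w hw
    rw [← aForm_eq_aFormL]
    have h1 := hcoer w hw
    have h2 := min_mul_norm_sq_le_normH1κSq κ w
    have h3 : 0 ≤ β * ‖toL2 Ω w‖ ^ 2 := by positivity
    linarith
  obtain ⟨C, hC⟩ := exists_continuousLinearMap_iff_galerkin (H := H1 Ω) (W := 𝒯.W)
    (aFormL hA κ β) 𝒯.isClosed_W
    (by positivity) hcoerL
  refine ⟨C, fun v c => ?_⟩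
  rw [← hC]
  refine and_congr Iff.rfl (forall₂_congr fun w _ => ?_)
  exact Eq.congr (aForm_eq_aFormL hA κ β c w) (aForm_eq_aFormL hA κ β v w)

/-- If the corrector is the operator `C`, then the LOD space is the image of `V_h` under
`I - C`. -/
theorem lodSpace_eq_map (𝒯 : Triangulation Ω) {A : Space d → Space d} {κ β : ℝ}
    {C : H1 Ω →L[ℝ] 𝒯.W} (hC : ∀ v c : H1 Ω, 𝒯.IsCorrector A κ β v c ↔ c = C v) :
    𝒯.lodSpace A κ β =
      𝒯.Vh.map (LinearMap.id - 𝒯.W.subtype.comp (C : H1 Ω →ₗ[ℝ] 𝒯.W)) := by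
  ext u
  constructor
  · rintro ⟨vh, hvh, c, hc, rfl⟩
    refine ⟨vh, hvh, ?_⟩
    rw [(hC vh c).1 hc]
    rfl
  · rintro ⟨vh, hvh, rfl⟩
    exact ⟨vh, hvh, C vh, (hC vh _).2 rfl, rfl⟩

end Triangulation

end GinzburgLandau

open GinzburgLandau
set_option maxHeartbeats 1000000 in
/-- Coercivity of the magnetic form `a_β` on the detail space `W` under the resolution condition
`h ≤ C_res κ⁻¹`, and well-definedness of the corrector `𝒞 : H¹(Ω) → W` and of the LOD space
`(I - 𝒞) V_h`, the image of `V_h` under the operator `I - 𝒞`. -/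
theorem lemma4p1 (d : ℕ) (hd : d = 2 ∨ d = 3) (Ω : TopologicalSpace.Opens (Space d))
    (hΩ : IsConvexPolytope Ω) (A : Space d → Space d)
    (hA : MemLp A ⊤ (volume.restrict (Ω : Set (Space d))))
    (hdiv : IsDivFree Ω A) (hn : HasZeroNormalTrace Ω A) (σ τ : ℝ) :
    ∃ Cres : ℝ, 0 < Cres ∧
      ∀ 𝒯 : Triangulation Ω, 𝒯.IsShapeRegular σ → 𝒯.IsQuasiUniform τ →
      ∀ κ : ℝ, 0 < κ → 𝒯.meshSize ≤ Cres * κ⁻¹ →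
      ∀ β : ℝ, 0 ≤ β →
        (∀ w ∈ 𝒯.W,
          1 / 4 * normH1κSq κ w + β * ‖toL2 Ω w‖ ^ 2 ≤ aForm A κ β w w) ∧
        (∀ v : H1 Ω, ∃! c : H1 Ω, 𝒯.IsCorrector A κ β v c) ∧
        ∃ C : H1 Ω →L[ℝ] 𝒯.W,
          (∀ v c : H1 Ω, 𝒯.IsCorrector A κ β v c ↔ c = C v) ∧
          𝒯.lodSpace A κ β =
            𝒯.Vh.map (LinearMap.id - 𝒯.W.subtype.comp (C : H1 Ω →ₗ[ℝ] 𝒯.W)) := by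
  have hP0 : 0 ≤ 4 * (4 * (|σ| * |τ|)) ^ d := by positivity
  obtain ⟨c, hc0, hc⟩ := exists_pos_mul_sq_le_quarter
    (mul_nonneg hP0 (add_nonneg (by norm_num : (0 : ℝ) ≤ 1 / 4) (potentialBound_nonneg hA)))
  refine ⟨c, hc0, fun 𝒯 hσ hτ κ hκ hh β hβ => ?_⟩
  have hpoincare : ∀ w ∈ 𝒯.W,
      ‖toL2 Ω w‖ ^ 2 ≤
        4 * (4 * (|σ| * |τ|)) ^ d * 𝒯.meshSize ^ 2 * ∑ i, ‖grad w i‖ ^ 2 := fun w hw =>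
    𝒯.norm_toL2_sq_le_meshSize_sq hΩ hσ hτ hw
  have hcoer : ∀ w ∈ 𝒯.W,
      1 / 4 * normH1κSq κ w + β * ‖toL2 Ω w‖ ^ 2 ≤ aForm A κ β w w := fun w hw =>
    𝒯.quarter_normH1κSq_le_aForm hA hP0 hpoincare hc hh β hw
  obtain ⟨C, hC⟩ := 𝒯.exists_corrector hA hκ hβ hcoer
  exact ⟨hcoer, fun v => ⟨C v, (hC v _).2 rfl, fun c hc => (hC v c).1 hc⟩, C, hC,
    𝒯.lodSpace_eq_map hC⟩
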